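/- Let $\mu$ denote the Möbius function. For all real $x>0$ and $a>0$, $$\frac{\pi}{2}\sum_{n\ge1}\frac{\mu(n)}{n}e^{-ax/n}=a\int_{0}^{\infty}\left(\sum_{n\ge1}\frac{\mu(n)}{n^2}e^{-a^2y/n^2}\right)\frac{\sqrt{\pi}}{2}\,y^{-1/2}e^{-x^2/(4y)}\,dy.$$ Here the series on the left is the limit of its partial sums $\sum_{n=1}^{N}$ as $N\to\infty$ (it converges, but not absolutely), the series under the integral converges absolutely for every $y>0$, and the integral converges absolutely, as a Lebesgue integral over $(0,\infty)$. -/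

import Mathlib

/-- The term `μ(n) / n² · exp (-t / n²)` of the Riesz series; it vanishes at `n = 0`
since `μ(0) = 0` in Mathlib. -/
noncomputable def rieszTerm (t : ℝ) (n : ℕ) : ℝ :=
  (ArithmeticFunction.moebius n : ℝ) / (n : ℝ) ^ 2 * Real.exp (-t / (n : ℝ) ^ 2)

/-- The Riesz function in the form `∑_{n ≥ 1} μ(n) / n² · exp (-t / n²)`. -/
noncomputable def rieszFun (t : ℝ) : ℝ :=
  ∑' n : ℕ, rieszTerm t n

/-- The kernel `(√π / 2) · y^(-1/2) · exp (-x² / (4 y))`, used for `y > 0`. -/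
noncomputable def heatFactor (x y : ℝ) : ℝ :=
  Real.sqrt Real.pi / 2 * y ^ (-(1 / 2) : ℝ) * Real.exp (-x ^ 2 / (4 * y))

/-- The partial sum `∑_{n = 1}^{N} μ(n) / n · exp (-a x / n)`. The full series converges only
conditionally, so its value is the limit of these sums and not a `tsum`. -/
noncomputable def gramDerivPartialSum (a x : ℝ) (N : ℕ) : ℝ :=
  ∑ n ∈ Finset.Icc 1 N,
    (ArithmeticFunction.moebius n : ℝ) / (n : ℝ) * Real.exp (-(a * x) / (n : ℝ))

/-! For a single n, completing the square evaluates the heat-kernel integral of exp(-a²y/n²), and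
multiplication by a μ(n)/n² gives exactly π/2 · μ(n)/n · e^{-ax/n}. The difficulty is the
interchange: these integrals have size 1/n, so the sum and the integral do not commute absolutely.

Summation by parts replaces μ(n) by the Mertens function M(n) and the weights by their successive
differences, whose integrals are O(1/n²). The interchange is then absolute once ∑ |M(n)|/n² < ∞
(`summable_abs_mertens_div_sq`), which also gives M(N)/N → 0 and so removes the boundary terms.

That convergence is proved by Mellin–Plancherel. On Re s = σ > 1, the derivative of 1/(s ζ(s)) is,
up to sign, the Fourier transform of v e^{-σv} M(e^v). The 3-4-1 inequality and growth bounds for ζ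
and ζ' make this derivative O(|t|^{-3/4}) uniformly as σ → 1, hence bounded in L². Fatou's lemma
puts v e^{-v} M(e^v) in L², and pairing it with 1/v on (1, ∞) makes e^{-v} |M(e^v)| integrable. -/

section

/-! ### Plancherel's identity on L¹ with an L² transform. -/

open MeasureTheory FourierTransform

/-- Plancherel's identity for an integrable function whose Fourier transform is in `L²`. -/
theorem eLpNorm_two_eq_eLpNorm_fourier {f : ℝ → ℂ} (hf : Integrable f)
    (hF : MemLp (𝓕 f) 2 volume) : eLpNorm f 2 volume = eLpNorm (𝓕 f) 2 volume := by
  let G : Lp (α := ℝ) ℂ 2 volume := hF.toLp (𝓕 f)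
  let g : Lp (α := ℝ) ℂ 2 volume := 𝓕⁻ G
  have hgG : 𝓕 g = G := FourierTransform.fourier_fourierInv_eq G
  -- Both sides equal ∫ φ · 𝓕 f: for f by Fubini, for g by the Fourier transform of tempered
  -- distributions. So f and its L² candidate g agree against every Schwartz function.
  have key : ∀ φ : SchwartzMap ℝ ℂ, ∫ x, (𝓕 φ) x • f x = ∫ x, (𝓕 φ) x • g x := by
    intro φ
    have h1 : ∫ x, (𝓕 φ) x • g x = ∫ x, φ x • G x := by
      rw [← Lp.toTemperedDistribution_apply, ← TemperedDistribution.fourier_apply,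
        Lp.fourier_toTemperedDistribution_eq, hgG, Lp.toTemperedDistribution_apply]
    have h2 : ∫ x, φ x • G x = ∫ x, φ x • 𝓕 f x := by
      refine integral_congr_ae ?_
      filter_upwards [hF.coeFn_toLp] with x hx
      rw [show G x = hF.toLp (𝓕 f) x from rfl, hx]
    rw [h1, h2, SchwartzMap.fourier_coe]
    have h := VectorFourier.integral_fourierIntegral_smul_eq_flip (μ := volume) (ν := volume)
      (L := innerₗ ℝ) (f := φ) (g := f) Real.continuous_fourierChar
      (by exact continuous_inner) φ.integrable hf
    rw [flip_innerₗ] at h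
    exact h
  have hfg : ∀ᵐ x, f x = g x := by
    refine ae_eq_of_integral_contDiff_smul_eq hf.locallyIntegrable
      ((Lp.memLp g).locallyIntegrable (by norm_num)) fun u hu hc => ?_
    have hcc : HasCompactSupport fun x => (u x : ℂ) := hc.comp_left (g := ((↑) : ℝ → ℂ)) (by simp)
    have hcs : ContDiff ℝ (↑(⊤ : ℕ∞)) fun x => (u x : ℂ) := Complex.ofRealCLM.contDiff.comp hu
    have := key (𝓕⁻ (hcc.toSchwartzMap hcs))
    rw [FourierTransform.fourier_fourierInv_eq] at this
    simpa using this
  calc eLpNorm f 2 volume = eLpNorm g 2 volume := eLpNorm_congr_ae hfg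
    _ = eLpNorm G 2 volume := by
      have : ‖g‖ = ‖G‖ := by rw [← hgG, Lp.norm_fourier_eq]
      rw [Lp.norm_def, Lp.norm_def] at this
      exact (ENNReal.toReal_eq_toReal_iff' (Lp.eLpNorm_ne_top g) (Lp.eLpNorm_ne_top G)).1 this
    _ = eLpNorm (𝓕 f) 2 volume := eLpNorm_congr_ae hF.coeFn_toLp

theorem lintegral_sq_eq_lintegral_fourier_sq {f : ℝ → ℂ} (hf : Integrable f)
    (hF : MemLp (𝓕 f) 2 volume) : ∫⁻ x, ‖f x‖ₑ ^ 2 = ∫⁻ x, ‖𝓕 f x‖ₑ ^ 2 := by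
  have h := congrArg (· ^ 2) (eLpNorm_two_eq_eLpNorm_fourier hf hF)
  have e (u : ℝ → ℂ) : eLpNorm u 2 volume ^ 2 = ∫⁻ x, ‖u x‖ₑ ^ 2 := by
    simpa using eLpNorm_nnreal_pow_eq_lintegral (f := u) (μ := volume) (p := 2) (by norm_num)
  simpa only [e] using h

end

/-! ### Laplace transform of the heat factor. -/

section

open MeasureTheory Set Real

/-- The Cauchy–Schlömilch substitution in the form used for Laplace transforms of heat kernels. -/
theorem integral_cauchy_schlomilch {b c : ℝ} (hb : 0 < b) (hc : 0 < c) :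
    IntegrableOn (fun y : ℝ => (√y)⁻¹ * exp (-(b * √y - c / √y) ^ 2)) (Ioi 0) ∧
    ∫ y in Ioi (0 : ℝ), (√y)⁻¹ * exp (-(b * √y - c / √y) ^ 2) = √π / b := by
  set φ : ℝ → ℝ := fun y => b * √y - c / √y with hφ
  set φ' : ℝ → ℝ := fun y => b / 2 * (√y)⁻¹ + c / 2 * ((√y)⁻¹ / y) with hφ'
  have hder : ∀ y ∈ Ioi (0 : ℝ), HasDerivWithinAt φ (φ' y) (Ioi 0) y := by
    intro y hy
    have hy : 0 < y := hy
    have hs : 0 < √y := sqrt_pos.2 hy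
    have h1 := (hasDerivAt_id y).sqrt hy.ne'
    have h2 := (h1.const_mul b).sub ((hasDerivAt_const y c).div h1 hs.ne')
    refine (h2.congr_deriv ?_).hasDerivWithinAt
    have : y = √y ^ 2 := (sq_sqrt hy.le).symm
    simp only [hφ', id]
    rw [sq_sqrt hy.le]
    field_simp
    ring
  have hpos : ∀ y ∈ Ioi (0 : ℝ), 0 < φ' y := by
    intro y hy
    have hy : 0 < y := hy
    have hs : 0 < √y := sqrt_pos.2 hy
    simp only [hφ']; positivity
  have hinj : InjOn φ (Ioi 0) := by
    intro y hy z hz h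
    have hs : 0 < √y := sqrt_pos.2 hy
    have ht : 0 < √z := sqrt_pos.2 hz
    have h3 : (√y - √z) * (b * √y * √z + c) = 0 := by
      simp only [hφ] at h
      field_simp at h
      linear_combination h
    have h4 : √y = √z := by
      rcases mul_eq_zero.1 h3 with h | h
      · linarith
      · have : 0 < b * √y * √z + c := by positivity
        linarith
    exact (sqrt_inj (le_of_lt hy) (le_of_lt hz)).1 h4
  have himg : φ '' Ioi 0 = univ := by
    refine eq_univ_of_forall fun w => ?_
    have hd : 0 < w ^ 2 + 4 * b * c := by positivity
    have hz : 0 < w + √(w ^ 2 + 4 * b * c) := by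
      have : |w| < √(w ^ 2 + 4 * b * c) := by
        rw [← sqrt_sq_eq_abs]
        exact sqrt_lt_sqrt (sq_nonneg _) (by nlinarith [mul_pos hb hc])
      linarith [neg_abs_le w]
    -- The square of the positive root q of b q² - w q - c = 0, where q = √y.
    refine ⟨((w + √(w ^ 2 + 4 * b * c)) / (2 * b)) ^ 2, mem_Ioi.2 (by positivity), ?_⟩
    simp only [hφ]
    rw [sqrt_sq (by positivity)]
    have := sq_sqrt hd.le
    generalize √(w ^ 2 + 4 * b * c) = q at hz this ⊢
    rw [← sub_eq_zero]
    field_simp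
    linear_combination this
  have hint : IntegrableOn (fun y => φ' y * exp (-(φ y) ^ 2)) (Ioi 0) := by
    have h := (integrableOn_image_iff_integrableOn_abs_deriv_smul measurableSet_Ioi hder hinj
      (fun w => exp (-w ^ 2))).1 (by
        rw [himg, integrableOn_univ]; simpa using integrable_exp_neg_mul_sq one_pos)
    refine h.congr_fun (fun y hy => ?_) measurableSet_Ioi
    simp [abs_of_pos (hpos y hy)]
  have hval : ∫ y in Ioi (0 : ℝ), φ' y * exp (-(φ y) ^ 2) = √π := by
    have h := integral_image_eq_integral_abs_deriv_smul measurableSet_Ioi hder hinj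
      (fun w => exp (-w ^ 2))
    rw [himg, setIntegral_univ] at h
    have h2 : ∫ w : ℝ, exp (-w ^ 2) = √π := by simpa using integral_gaussian 1
    rw [← h2, h]
    refine setIntegral_congr_fun measurableSet_Ioi fun y hy => ?_
    simp [abs_of_pos (hpos y hy)]
  have hmeas : Measurable fun y => (√y)⁻¹ * exp (-(φ y) ^ 2) := by
    simp only [hφ]; fun_prop
  have hi1 : IntegrableOn (fun y => (√y)⁻¹ * exp (-(φ y) ^ 2)) (Ioi 0) := by
    refine Integrable.mono' (hint.const_mul (2 / b)) hmeas.aestronglyMeasurable ?_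
    filter_upwards [ae_restrict_mem measurableSet_Ioi] with y hy
    have hy : 0 < y := hy
    have hs : 0 < √y := sqrt_pos.2 hy
    rw [norm_of_nonneg (by positivity), ← mul_assoc]
    refine mul_le_mul_of_nonneg_right ?_ (exp_pos _).le
    simp only [hφ', mul_add]
    have h1 : 2 / b * (b / 2 * (√y)⁻¹) = (√y)⁻¹ := by field_simp
    have h2 : 0 ≤ 2 / b * (c / 2 * ((√y)⁻¹ / y)) := by positivity
    linarith
  have hi2 : IntegrableOn (fun y => (√y)⁻¹ / y * exp (-(φ y) ^ 2)) (Ioi 0) := by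
    refine IntegrableOn.congr_fun ((hint.sub (hi1.const_mul (b / 2))).const_mul (2 / c)) (fun y hy => ?_) measurableSet_Ioi
    simp only [hφ', Pi.sub_apply]
    field_simp
    ring
  -- The involution y ↦ (c/b)²/y sends φ to -φ and exchanges the two summands of φ', so each
  -- contributes half of the Gaussian integral `hval`.
  have hsub : ∫ y in Ioi (0 : ℝ), (√y)⁻¹ * exp (-(φ y) ^ 2) =
      ∫ y in Ioi (0 : ℝ), c / b * ((√y)⁻¹ / y * exp (-(φ y) ^ 2)) := by
    have hder2 : ∀ y ∈ Ioi (0 : ℝ), HasDerivWithinAt (fun y => (c / b) ^ 2 / y)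
        (-((c / b) ^ 2 / y ^ 2)) (Ioi 0) y := by
      intro y hy
      have hy : 0 < y := hy
      have h := (hasDerivAt_const y ((c / b) ^ 2)).div (hasDerivAt_id y) hy.ne'
      refine (h.congr_deriv ?_).hasDerivWithinAt
      simp; ring
    have hinj2 : InjOn (fun y => (c / b) ^ 2 / y) (Ioi (0 : ℝ)) := by
      intro y hy z hz h
      have hy : 0 < y := hy
      have hz : 0 < z := hz
      have hk : (c / b) ^ 2 ≠ 0 := by positivity
      simp only at h
      rw [div_eq_div_iff hy.ne' hz.ne'] at h
      exact (mul_left_cancel₀ hk h).symm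
    have himg2 : (fun y => (c / b) ^ 2 / y) '' Ioi (0 : ℝ) = Ioi 0 := by
      ext w
      constructor
      · rintro ⟨y, hy, rfl⟩
        have hy : 0 < y := hy
        exact mem_Ioi.2 (by positivity)
      · intro hw
        have hw : 0 < w := hw
        exact ⟨(c / b) ^ 2 / w, mem_Ioi.2 (by positivity), by simp only; field_simp⟩
    have h := integral_image_eq_integral_abs_deriv_smul measurableSet_Ioi hder2 hinj2
      (fun y => (√y)⁻¹ * exp (-(φ y) ^ 2))
    rw [himg2] at h
    rw [h]
    refine setIntegral_congr_fun measurableSet_Ioi fun y hy => ?_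
    have hy : 0 < y := hy
    have hs : 0 < √y := sqrt_pos.2 hy
    have hsq : √((c / b) ^ 2 / y) = c / b / √y := by
      rw [sqrt_div (sq_nonneg _), sqrt_sq (by positivity)]
    have hφψ : φ ((c / b) ^ 2 / y) = -φ y := by
      simp only [hφ, hsq]
      field_simp
      ring
    simp only [hφψ, hsq, abs_neg, smul_eq_mul, neg_sq]
    rw [abs_of_pos (by positivity), ← mul_assoc, ← mul_assoc]
    congr 1
    have : y = √y ^ 2 := (sq_sqrt hy.le).symm
    have hyy : y ^ 2 = √y ^ 2 * y := by rw [← this, sq]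
    rw [hyy]
    field_simp
  refine ⟨hi1, ?_⟩
  change ∫ y in Ioi (0 : ℝ), (√y)⁻¹ * exp (-(φ y) ^ 2) = _
  have hsplit : √π = b / 2 * (∫ y in Ioi (0 : ℝ), (√y)⁻¹ * exp (-(φ y) ^ 2)) +
      c / 2 * ∫ y in Ioi (0 : ℝ), (√y)⁻¹ / y * exp (-(φ y) ^ 2) := by
    rw [← hval, ← integral_const_mul, ← integral_const_mul,
      ← integral_add (hi1.const_mul _) (hi2.const_mul _)]
    congr 1; ext y; simp only [hφ']; ring
  rw [integral_const_mul] at hsub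
  rw [eq_div_iff hb.ne']
  rw [hsplit]
  have : (∫ y in Ioi (0 : ℝ), (√y)⁻¹ / y * exp (-(φ y) ^ 2)) =
      b / c * ∫ y in Ioi (0 : ℝ), (√y)⁻¹ * exp (-(φ y) ^ 2) := by
    rw [hsub]; field_simp
  rw [this]
  field_simp
  ring

/-- Cauchy–Schlömilch with c = x/2, since (b√y - x/(2√y))² = b²y - bx + x²/(4y). -/
theorem integrableOn_exp_mul_heatFactor {x b : ℝ} (hx : 0 < x) (hb : 0 < b) :
    IntegrableOn (fun y : ℝ => exp (-(b ^ 2 * y)) * heatFactor x y) (Ioi 0) ∧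
    ∫ y in Ioi (0 : ℝ), exp (-(b ^ 2 * y)) * heatFactor x y = π / 2 / b * exp (-(b * x)) := by
  obtain ⟨h1, h2⟩ := integral_cauchy_schlomilch hb (half_pos hx)
  have e : EqOn (fun y : ℝ => √π / 2 * exp (-(b * x)) *
      ((√y)⁻¹ * exp (-(b * √y - x / 2 / √y) ^ 2)))
      (fun y : ℝ => exp (-(b ^ 2 * y)) * heatFactor x y) (Ioi 0) := by
    intro y hy
    have hy : 0 < y := hy
    have hs : 0 < √y := sqrt_pos.2 hy
    have hexp : exp (-(b * x)) * exp (-(b * √y - x / 2 / √y) ^ 2) =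
        exp (-(b ^ 2 * y)) * exp (-x ^ 2 / (4 * y)) := by
      rw [← exp_add, ← exp_add]
      congr 1
      have : y = √y ^ 2 := (sq_sqrt hy.le).symm
      rw [this, sqrt_sq hs.le]
      field_simp
      ring
    simp only [heatFactor]
    rw [rpow_neg hy.le, ← sqrt_eq_rpow]
    linear_combination √π / 2 * (√y)⁻¹ * hexp
  refine ⟨IntegrableOn.congr_fun (h1.const_mul _) e measurableSet_Ioi, ?_⟩
  rw [← setIntegral_congr_fun measurableSet_Ioi e, integral_const_mul, h2]
  have : √π * √π = π := mul_self_sqrt pi_pos.le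
  field_simp
  linear_combination this

end

/-! ### The Mertens function and summation by parts. -/

section

open MeasureTheory Set Filter Topology

/-- The Mertens function `∑_{k ≤ n} μ(k)`. -/
noncomputable def mertens (n : ℕ) : ℝ :=
  ∑ k ∈ Finset.Icc 1 n, (ArithmeticFunction.moebius k : ℝ)

theorem abs_moebius_cast_le_one (n : ℕ) : |(ArithmeticFunction.moebius n : ℝ)| ≤ 1 := by
  exact_mod_cast ArithmeticFunction.abs_moebius_le_one (n := n)

@[simp] theorem mertens_zero : mertens 0 = 0 := by simp [mertens]

theorem mertens_succ (n : ℕ) :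
    mertens (n + 1) = mertens n + (ArithmeticFunction.moebius (n + 1) : ℝ) := by
  rw [mertens, Finset.sum_Icc_succ_top (by omega)]; rfl

theorem abs_mertens_le (n : ℕ) : |mertens n| ≤ n := by
  induction n with
  | zero => simp
  | succ n ih =>
    rw [mertens_succ]; push_cast
    exact (abs_add_le _ _).trans (add_le_add ih (abs_moebius_cast_le_one _))

/-- Abel summation. As M(0) = 0, the value g 0 plays no role. -/
theorem sum_range_mertens_mul_sub (g : ℕ → ℝ) (N : ℕ) :
    ∑ n ∈ Finset.range N, mertens n * (g n - g (n + 1)) + mertens N * g N =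
      ∑ n ∈ Finset.Icc 1 N, (ArithmeticFunction.moebius n : ℝ) * g n := by
  induction N with
  | zero => simp
  | succ N ih =>
    rw [Finset.sum_range_succ, Finset.sum_Icc_succ_top (by omega), ← ih, mertens_succ]
    ring

/-- M changes by at most 1 at each step, so M² grows by at most 2|M| + 1. This turns control of the
mean of |M| into a pointwise bound. -/
theorem mertens_sq_le (N : ℕ) : mertens N ^ 2 ≤ 2 * ∑ n ∈ Finset.range N, |mertens n| + N := by
  induction N with
  | zero => simp
  | succ N ih =>
    rw [Finset.sum_range_succ, mertens_succ]
    push_cast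
    have h := abs_le.1 (abs_moebius_cast_le_one (N + 1))
    have h1 : mertens N * (ArithmeticFunction.moebius (N + 1) : ℝ) ≤ |mertens N| := by
      refine (le_abs_self _).trans ?_
      rw [abs_mul]
      exact mul_le_of_le_one_right (abs_nonneg _) (abs_moebius_cast_le_one _)
    nlinarith

/-- Convergence of `∑ |M(n)| / n²` forces `M(n) = o(n)`. -/
theorem tendsto_mertens_div (hK : Summable fun n : ℕ => |mertens n| / (n : ℝ) ^ 2) :
    Tendsto (fun N : ℕ => mertens N / N) atTop (𝓝 0) := by
  -- Dominated convergence: N⁻² ∑_{n<N} |M(n)| → 0, since each term tends to 0 and is at most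
  -- |M(n)|/n².
  have h1 : Tendsto (fun N : ℕ => ∑' n : ℕ,
      if n < N then |mertens n| / (N : ℝ) ^ 2 else 0) atTop (𝓝 (∑' _ : ℕ, (0 : ℝ))) := by
    refine tendsto_tsum_of_dominated_convergence hK (fun n => ?_) (Eventually.of_forall ?_)
    · have : Tendsto (fun N : ℕ => |mertens n| / (N : ℝ) ^ 2) atTop (𝓝 0) :=
        tendsto_const_nhds.div_atTop
          ((tendsto_pow_atTop two_ne_zero).comp tendsto_natCast_atTop_atTop)
      refine squeeze_zero (fun N => ?_) (fun N => ?_) this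
      · split_ifs <;> positivity
      · split_ifs
        · exact le_rfl
        · positivity
    · intro N n
      split_ifs with h
      · rcases Nat.eq_zero_or_pos n with rfl | hn
        · simp
        · have : (0 : ℝ) < n := by exact_mod_cast hn
          rw [Real.norm_of_nonneg (by positivity)]
          gcongr
      · simp; positivity
  rw [tsum_zero] at h1
  have h2 : ∀ N : ℕ, (∑' n : ℕ, if n < N then |mertens n| / (N : ℝ) ^ 2 else 0) =
      (∑ n ∈ Finset.range N, |mertens n|) / (N : ℝ) ^ 2 := by
    intro N
    rw [tsum_eq_sum (s := Finset.range N), Finset.sum_div]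
    · exact Finset.sum_congr rfl fun n hn => by rw [if_pos (Finset.mem_range.1 hn)]
    · intro n hn
      rw [if_neg (by simpa using hn)]
  simp only [h2] at h1
  have h3 : Tendsto (fun N : ℕ => (mertens N / N) ^ 2) atTop (𝓝 0) := by
    refine squeeze_zero' (Eventually.of_forall fun N => sq_nonneg _) ?_
      (by simpa using (h1.const_mul 2).add tendsto_one_div_atTop_nhds_zero_nat)
    filter_upwards [eventually_gt_atTop 0] with N hN
    have hN' : (0 : ℝ) < N := by exact_mod_cast hN
    have := mertens_sq_le N
    rw [div_pow, div_le_iff₀ (by positivity)]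
    refine this.trans (le_of_eq ?_)
    field_simp
  have h4 := h3.sqrt
  simp only [Real.sqrt_sq_eq_abs, Real.sqrt_zero] at h4
  exact (tendsto_zero_iff_abs_tendsto_zero _).2 h4

theorem integrable_tsum_of_summable_integral_norm {α : Type*} [MeasurableSpace α]
    {ν : Measure α} {F : ℕ → α → ℝ} {f : α → ℝ} (hF : ∀ n, Integrable (F n) ν)
    (hs : Summable fun n => ∫ y, ‖F n y‖ ∂ν) (hf : ∀ᵐ y ∂ν, HasSum (fun n => F n y) (f y)) :
    Integrable f ν := by
  have hm : AEStronglyMeasurable f ν :=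
    aestronglyMeasurable_of_tendsto_ae atTop
      (f := fun N y => ∑ n ∈ Finset.range N, F n y)
      (fun N => (integrable_finsetSum _ fun n _ => hF n).aestronglyMeasurable)
      (by filter_upwards [hf] with y hy using hy.tendsto_sum_nat)
  refine ⟨hm, ?_⟩
  have h1 : ∫⁻ y, ‖f y‖ₑ ∂ν ≤ ∫⁻ y, ∑' n, ‖F n y‖ₑ ∂ν := by
    refine lintegral_mono_ae ?_
    filter_upwards [hf] with y hy
    rw [← hy.tsum_eq]
    exact enorm_tsum_le_tsum_enorm
  refine lt_of_le_of_lt h1 ?_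
  rw [lintegral_tsum fun n => (hF n).aestronglyMeasurable.enorm]
  have h2 : ∀ n, ∫⁻ y, ‖F n y‖ₑ ∂ν = ENNReal.ofReal (∫ y, ‖F n y‖ ∂ν) := fun n =>
    (ofReal_integral_norm_eq_lintegral_enorm (hF n)).symm
  simp only [h2]
  rw [← ENNReal.ofReal_tsum_of_nonneg (fun n => integral_nonneg fun y => norm_nonneg _) hs]
  exact ENNReal.ofReal_lt_top

end

/-! ### Interchange of sum and integral, given ∑ |M(n)|/n² < ∞. -/

section

open MeasureTheory Set Filter Topology

theorem abs_rieszTerm_le {t : ℝ} (ht : 0 ≤ t) (n : ℕ) : |rieszTerm t n| ≤ 1 / (n : ℝ) ^ 2 := by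
  have h1 : Real.exp (-t / (n : ℝ) ^ 2) ≤ 1 :=
    Real.exp_le_one_iff.2 (div_nonpos_of_nonpos_of_nonneg (by linarith) (by positivity))
  rw [rieszTerm, abs_mul, abs_div, abs_of_nonneg (sq_nonneg (n : ℝ)), Real.abs_exp]
  calc _ ≤ 1 / (n : ℝ) ^ 2 * 1 := by
        gcongr
        exact abs_moebius_cast_le_one n
    _ = _ := mul_one _

theorem summable_rieszTerm {t : ℝ} (ht : 0 ≤ t) : Summable (rieszTerm t) :=
  Summable.of_norm_bounded (Real.summable_one_div_nat_pow.2 one_lt_two) (abs_rieszTerm_le ht)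

/-- The Riesz weight `exp (-t / n²) / n²`. -/
noncomputable def rieszWeight (t : ℝ) (n : ℕ) : ℝ := Real.exp (-t / (n : ℝ) ^ 2) / (n : ℝ) ^ 2

theorem rieszWeight_nonneg (t : ℝ) (n : ℕ) : 0 ≤ rieszWeight t n := by
  unfold rieszWeight; positivity

theorem rieszWeight_le {t : ℝ} (ht : 0 ≤ t) (n : ℕ) : rieszWeight t n ≤ 1 / (n : ℝ) ^ 2 := by
  unfold rieszWeight
  gcongr
  exact Real.exp_le_one_iff.2 (div_nonpos_of_nonpos_of_nonneg (by linarith) (by positivity))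

/-- Abel summation of the Riesz series; the boundary term is at most |M(N)|/N². In this form the
series can be integrated termwise. -/
theorem hasSum_mertens_mul_rieszWeight_sub
    (hK : Summable fun n : ℕ => |mertens n| / (n : ℝ) ^ 2) {t : ℝ} (ht : 0 ≤ t) :
    HasSum (fun n : ℕ => mertens n * (rieszWeight t n - rieszWeight t (n + 1))) (rieszFun t) := by
  have hs : Summable fun n : ℕ => mertens n * (rieszWeight t n - rieszWeight t (n + 1)) := by
    refine Summable.of_norm_bounded hK fun n => ?_
    rcases Nat.eq_zero_or_pos n with rfl | hn
    · simp
    have hn' : (0 : ℝ) < n := by exact_mod_cast hn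
    rw [Real.norm_eq_abs, abs_mul, div_eq_mul_one_div]
    refine mul_le_mul_of_nonneg_left ?_ (abs_nonneg _)
    have h1 := rieszWeight_le ht n
    have h2 := rieszWeight_le ht (n + 1)
    have h3 : 1 / ((n + 1 : ℕ) : ℝ) ^ 2 ≤ 1 / (n : ℝ) ^ 2 := by
      gcongr; omega
    exact abs_le.2 ⟨by linarith [rieszWeight_nonneg t n], by linarith [rieszWeight_nonneg t (n + 1)]⟩
  have h1 := hs.hasSum.tendsto_sum_nat
  have h2 : Tendsto (fun N : ℕ => mertens N * rieszWeight t N) atTop (𝓝 0) := by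
    have h0 := (tendsto_mertens_div hK)
    refine squeeze_zero_norm (fun N => ?_) ((tendsto_zero_iff_abs_tendsto_zero _).1 h0)
    rcases Nat.eq_zero_or_pos N with rfl | hN
    · simp
    have hN' : (1 : ℝ) ≤ N := by exact_mod_cast hN
    rw [Real.norm_eq_abs, abs_mul, abs_of_nonneg (rieszWeight_nonneg _ _), Function.comp_apply,
      abs_div, Nat.abs_cast, div_eq_mul_one_div]
    refine mul_le_mul_of_nonneg_left ((rieszWeight_le ht N).trans ?_) (abs_nonneg _)
    gcongr
    nlinarith
  have h3 := h1.add h2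
  simp only [sum_range_mertens_mul_sub, add_zero] at h3
  have h4 : Tendsto (fun N : ℕ => ∑ n ∈ Finset.Icc 1 N,
      (ArithmeticFunction.moebius n : ℝ) * rieszWeight t n) atTop (𝓝 (rieszFun t)) := by
    have := (summable_rieszTerm ht).hasSum.tendsto_sum_nat.comp (tendsto_add_atTop_nat 1)
    refine this.congr fun N => ?_
    simp only [Function.comp_apply]
    rw [Finset.sum_range_eq_add_Ico _ (by omega), ← Finset.Ico_add_one_right_eq_Icc]
    simp only [rieszTerm, rieszWeight]
    simp [div_mul_eq_mul_div, mul_div_assoc]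
  rw [tendsto_nhds_unique h4 h3]
  exact hs.hasSum

/-- The difference of weights is split into two parts of known sign. The resulting majorant is
linear in the exponentials, so its integral against the heat factor is explicit. -/
theorem abs_rieszWeight_sub_le {t : ℝ} (ht : 0 ≤ t) {n : ℕ} (hn : 0 < n) :
    |rieszWeight t n - rieszWeight t (n + 1)| ≤
      (1 / (n : ℝ) ^ 2 - 1 / ((n : ℝ) + 1) ^ 2) * Real.exp (-t / (n : ℝ) ^ 2) +
      1 / ((n : ℝ) + 1) ^ 2 *
        (Real.exp (-t / ((n : ℝ) + 1) ^ 2) - Real.exp (-t / (n : ℝ) ^ 2)) := by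
  have hn' : (0 : ℝ) < n := by exact_mod_cast hn
  have h1 : 1 / ((n : ℝ) + 1) ^ 2 ≤ 1 / (n : ℝ) ^ 2 := by gcongr; linarith
  have h2 : Real.exp (-t / (n : ℝ) ^ 2) ≤ Real.exp (-t / ((n : ℝ) + 1) ^ 2) := by
    refine Real.exp_le_exp.2 ?_
    rw [neg_div, neg_div, neg_le_neg_iff]
    gcongr; linarith
  have h3 := mul_nonneg (sub_nonneg.2 h1) (Real.exp_pos (-t / (n : ℝ) ^ 2)).le
  have h4 := mul_nonneg (one_div_nonneg.2 (sq_nonneg ((n : ℝ) + 1))) (sub_nonneg.2 h2)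
  have h5 : rieszWeight t n - rieszWeight t (n + 1) =
      (1 / (n : ℝ) ^ 2 - 1 / ((n : ℝ) + 1) ^ 2) * Real.exp (-t / (n : ℝ) ^ 2) -
      1 / ((n : ℝ) + 1) ^ 2 *
        (Real.exp (-t / ((n : ℝ) + 1) ^ 2) - Real.exp (-t / (n : ℝ) ^ 2)) := by
    simp only [rieszWeight]; push_cast; ring
  rw [h5, abs_le]
  constructor <;> linarith

section

variable {x a : ℝ}

theorem integrableOn_exp_div_sq_mul_heatFactor (hx : 0 < x) (ha : 0 < a) {n : ℕ} (hn : 0 < n) :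
    IntegrableOn (fun y : ℝ => Real.exp (-(a ^ 2 * y) / (n : ℝ) ^ 2) * heatFactor x y) (Ioi 0) ∧
    ∫ y in Ioi (0 : ℝ), Real.exp (-(a ^ 2 * y) / (n : ℝ) ^ 2) * heatFactor x y =
      Real.pi / (2 * a) * (n * Real.exp (-(a * x) / n)) := by
  have hn' : (0 : ℝ) < n := by exact_mod_cast hn
  obtain ⟨h1, h2⟩ := integrableOn_exp_mul_heatFactor hx (div_pos ha hn')
  have e : ∀ y : ℝ, -((a / n) ^ 2 * y) = -(a ^ 2 * y) / (n : ℝ) ^ 2 := fun y => by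
    field_simp
  simp only [e] at h1 h2
  refine ⟨h1, h2.trans ?_⟩
  rw [show -(a / n * x) = -(a * x) / n by ring]
  field_simp

theorem heatFactor_nonneg {y : ℝ} (hy : 0 < y) : 0 ≤ heatFactor x y := by
  unfold heatFactor; positivity

theorem integral_rieszWeight_mul_heatFactor (hx : 0 < x) (ha : 0 < a) (n : ℕ) :
    IntegrableOn (fun y : ℝ => rieszWeight (a ^ 2 * y) n * heatFactor x y) (Ioi 0) ∧
    ∫ y in Ioi (0 : ℝ), rieszWeight (a ^ 2 * y) n * heatFactor x y =
      Real.pi / (2 * a) * (Real.exp (-(a * x) / n) / n) := by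
  rcases Nat.eq_zero_or_pos n with rfl | hn
  · simp [rieszWeight]
  have hn' : (0 : ℝ) < n := by exact_mod_cast hn
  obtain ⟨h1, h2⟩ := integrableOn_exp_div_sq_mul_heatFactor hx ha hn
  have e : ∀ y, rieszWeight (a ^ 2 * y) n * heatFactor x y = (1 / (n : ℝ) ^ 2) *
      (Real.exp (-(a ^ 2 * y) / (n : ℝ) ^ 2) * heatFactor x y) := fun y => by
    simp only [rieszWeight]; ring
  simp only [e]
  refine ⟨h1.const_mul _, ?_⟩
  rw [integral_const_mul, h2]
  field_simp

/-- The constant 3 + ax is 2 + (1 + ax). The first part of the majorant gives 2 because n(2n+1) ≤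
2(n+1)²; the second gives 1 + ax because e^{-ax/n} ≥ 1 - ax/n, so consecutive exponentials differ by
at most ax/n. -/
theorem integral_abs_rieszWeight_sub_le (hx : 0 < x) (ha : 0 < a) {n : ℕ} (hn : 0 < n) :
    ∫ y in Ioi (0 : ℝ), ‖(rieszWeight (a ^ 2 * y) n - rieszWeight (a ^ 2 * y) (n + 1)) *
      heatFactor x y‖ ≤ Real.pi / (2 * a) * (3 + a * x) / (n : ℝ) ^ 2 := by
  have hn' : (0 : ℝ) < n := by exact_mod_cast hn
  obtain ⟨h1, h2⟩ := integrableOn_exp_div_sq_mul_heatFactor hx ha hn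
  obtain ⟨h3, h4⟩ := integrableOn_exp_div_sq_mul_heatFactor hx ha n.succ_pos
  push_cast at h3 h4
  set c := Real.pi / (2 * a) with hc
  have h31 : IntegrableOn (fun y => Real.exp (-(a ^ 2 * y) / ((n : ℝ) + 1) ^ 2) * heatFactor x y -
      Real.exp (-(a ^ 2 * y) / (n : ℝ) ^ 2) * heatFactor x y) (Ioi 0) := h3.sub h1
  have hc0 : 0 ≤ c := by have := Real.pi_pos; positivity
  have hle : ∫ y in Ioi (0 : ℝ), ‖(rieszWeight (a ^ 2 * y) n - rieszWeight (a ^ 2 * y) (n + 1)) *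
      heatFactor x y‖ ≤ ∫ y in Ioi (0 : ℝ),
        ((1 / (n : ℝ) ^ 2 - 1 / ((n : ℝ) + 1) ^ 2) *
          (Real.exp (-(a ^ 2 * y) / (n : ℝ) ^ 2) * heatFactor x y) +
        1 / ((n : ℝ) + 1) ^ 2 * (Real.exp (-(a ^ 2 * y) / ((n : ℝ) + 1) ^ 2) * heatFactor x y -
          Real.exp (-(a ^ 2 * y) / (n : ℝ) ^ 2) * heatFactor x y)) := by
    refine setIntegral_mono_on ?_ ?_ measurableSet_Ioi fun y hy => ?_
    · have := (integral_rieszWeight_mul_heatFactor hx ha n).1.sub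
        (integral_rieszWeight_mul_heatFactor hx ha (n + 1)).1
      refine Integrable.norm ?_
      simp only [sub_mul]
      exact this
    · exact (h1.const_mul _).add (h31.const_mul _)
    · have hy : 0 < y := hy
      rw [norm_mul, Real.norm_of_nonneg (heatFactor_nonneg hy), Real.norm_eq_abs]
      refine (mul_le_mul_of_nonneg_right (abs_rieszWeight_sub_le (by positivity) hn)
        (heatFactor_nonneg hy)).trans (le_of_eq ?_)
      ring
  refine hle.trans ?_
  rw [integral_add (h1.const_mul _) (h31.const_mul _), integral_const_mul,
    integral_const_mul, integral_sub h3 h1, h2, h4]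
  set e := Real.exp (-(a * x) / n)
  set e' := Real.exp (-(a * x) / ((n : ℝ) + 1))
  have hax : 0 < a * x := mul_pos ha hx
  have he0 : 0 < e := Real.exp_pos _
  have he1 : e ≤ 1 := Real.exp_le_one_iff.2 (div_nonpos_of_nonpos_of_nonneg (by linarith) hn'.le)
  have he1' : e' ≤ 1 :=
    Real.exp_le_one_iff.2 (div_nonpos_of_nonpos_of_nonneg (by linarith) (by positivity))
  have hd : n * (e' - e) ≤ a * x := by
    have h5 : -(a * x) / n + 1 ≤ e := Real.add_one_le_exp _
    have h6 : n * (e' - e) ≤ n * (1 - (-(a * x) / n + 1)) := by gcongr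
    refine h6.trans (le_of_eq ?_)
    field_simp; ring
  have hA : (1 / (n : ℝ) ^ 2 - 1 / ((n : ℝ) + 1) ^ 2) * (c * (n * e)) ≤ c * 2 / (n : ℝ) ^ 2 := by
    have h7 : (1 / (n : ℝ) ^ 2 - 1 / ((n : ℝ) + 1) ^ 2) * (c * (n * e)) ≤
        (1 / (n : ℝ) ^ 2 - 1 / ((n : ℝ) + 1) ^ 2) * (c * (n * 1)) := by
      have : 1 / ((n : ℝ) + 1) ^ 2 ≤ 1 / (n : ℝ) ^ 2 := by gcongr; linarith
      have := sub_nonneg.2 this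
      gcongr
    refine h7.trans ?_
    have h8 : (1 / (n : ℝ) ^ 2 - 1 / ((n : ℝ) + 1) ^ 2) * (c * (n * 1)) =
        c * (n * (2 * n + 1) / ((n : ℝ) + 1) ^ 2) / (n : ℝ) ^ 2 := by
      field_simp; ring
    rw [h8]
    gcongr
    rw [div_le_iff₀ (by positivity)]
    nlinarith
  have hB : 1 / ((n : ℝ) + 1) ^ 2 * (c * (((n : ℝ) + 1) * e') - c * (n * e)) ≤
      c * (1 + a * x) / (n : ℝ) ^ 2 := by
    have h9 : c * (((n : ℝ) + 1) * e') - c * (n * e) = c * (e' + n * (e' - e)) := by ring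
    rw [h9, one_div_mul_eq_div]
    gcongr
    linarith
  refine (add_le_add hA hB).trans (le_of_eq ?_)
  ring

/-- The Abel-summed series is integrated termwise, then Abel summation is undone with the integrated
weights `I n`. The boundary term M(N) I(N) is O(|M(N)|/N). -/
theorem rieszFun_mul_heatFactor_of_summable_mertens
    (hK : Summable fun n : ℕ => |mertens n| / (n : ℝ) ^ 2) (hx : 0 < x) (ha : 0 < a) :
    IntegrableOn (fun y : ℝ => rieszFun (a ^ 2 * y) * heatFactor x y) (Ioi 0) ∧
    Tendsto (fun N : ℕ => Real.pi / 2 * gramDerivPartialSum a x N) atTop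
      (𝓝 (a * ∫ y in Ioi (0 : ℝ), rieszFun (a ^ 2 * y) * heatFactor x y)) := by
  set F : ℕ → ℝ → ℝ := fun n y => mertens n *
    ((rieszWeight (a ^ 2 * y) n - rieszWeight (a ^ 2 * y) (n + 1)) * heatFactor x y) with hF
  have hI := integral_rieszWeight_mul_heatFactor hx ha
  have hFi : ∀ n, IntegrableOn (F n) (Ioi 0) := fun n => by
    have := ((hI n).1.sub (hI (n + 1)).1).const_mul (mertens n)
    simp only [hF, sub_mul]
    exact this
  have hFn : Summable fun n => ∫ y in Ioi (0 : ℝ), ‖F n y‖ := by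
    refine Summable.of_norm_bounded (hK.mul_left (Real.pi / (2 * a) * (3 + a * x))) fun n => ?_
    rw [Real.norm_of_nonneg (integral_nonneg fun y => norm_nonneg _)]
    rcases Nat.eq_zero_or_pos n with rfl | hn
    · simp [hF]
    simp only [hF, norm_mul (mertens n), integral_const_mul]
    refine (mul_le_mul_of_nonneg_left (integral_abs_rieszWeight_sub_le hx ha hn)
      (norm_nonneg _)).trans (le_of_eq ?_)
    rw [Real.norm_eq_abs]; ring
  have hsum : ∀ y ∈ Ioi (0 : ℝ), HasSum (fun n => F n y)
      (rieszFun (a ^ 2 * y) * heatFactor x y) := fun y hy => by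
    have hy : 0 < y := hy
    simpa only [hF, mul_assoc] using
      (hasSum_mertens_mul_rieszWeight_sub hK (t := a ^ 2 * y) (by positivity)).mul_right
        (heatFactor x y)
  refine ⟨integrable_tsum_of_summable_integral_norm hFi hFn
    ((ae_restrict_mem measurableSet_Ioi).mono hsum), ?_⟩
  have h1 := hasSum_integral_of_summable_integral_norm hFi hFn
  rw [setIntegral_congr_fun measurableSet_Ioi fun y hy => (hsum y hy).tsum_eq] at h1
  set I : ℕ → ℝ := fun n => Real.pi / (2 * a) * (Real.exp (-(a * x) / n) / n) with hIdef
  have h2 : ∀ n, ∫ y in Ioi (0 : ℝ), F n y = mertens n * (I n - I (n + 1)) := fun n => by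
    simp only [hF, integral_const_mul, sub_mul]
    rw [integral_sub (hI n).1 (hI (n + 1)).1, (hI n).2, (hI (n + 1)).2]
  simp only [h2] at h1
  have h3 : Tendsto (fun N : ℕ => mertens N * I N) atTop (𝓝 0) := by
    have h0 := ((tendsto_zero_iff_abs_tendsto_zero _).1 (tendsto_mertens_div hK)).const_mul
      (Real.pi / (2 * a))
    rw [mul_zero] at h0
    refine squeeze_zero_norm (fun N => ?_) h0
    have hpi := Real.pi_pos
    have he : Real.exp (-(a * x) / N) ≤ 1 :=
      Real.exp_le_one_iff.2 (div_nonpos_of_nonpos_of_nonneg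
        (by linarith [mul_pos ha hx]) N.cast_nonneg)
    have e : mertens N * I N = Real.pi / (2 * a) * (mertens N / N) * Real.exp (-(a * x) / N) := by
      simp only [hIdef]; ring
    rw [e, Real.norm_eq_abs, abs_mul, abs_mul, Real.abs_exp,
      abs_of_nonneg (show 0 ≤ Real.pi / (2 * a) by positivity)]
    exact mul_le_of_le_one_right (by positivity) he
  have h4 := (h1.tendsto_sum_nat.add h3).const_mul a
  simp only [sum_range_mertens_mul_sub, add_zero] at h4
  refine h4.congr fun N => ?_
  simp only [gramDerivPartialSum, Finset.mul_sum, hIdef]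
  refine Finset.sum_congr rfl fun n _ => ?_
  field_simp

end

end

/-! ### Continuation of ζ(s) - 1/(s-1) to the left of Re s = 1. -/

section

open Set Filter Topology Complex

/-- The difference `n^{-s} - ∫_n^{n+1} u^{-s} du`, with `n` shifted by one. -/
noncomputable def zetaTerm (n : ℕ) (s : ℂ) : ℂ :=
  ((n : ℂ) + 1) ^ (-s) - (((n : ℂ) + 2) ^ (1 - s) - ((n : ℂ) + 1) ^ (1 - s)) / (1 - s)

/-- The sum of `zetaTerm`, which continues `ζ(s) - 1 / (s - 1)`. -/
noncomputable def zetaRest (s : ℂ) : ℂ := ∑' n : ℕ, zetaTerm n s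

theorem norm_ofReal_cpow_neg {u : ℝ} (hu : 0 < u) (s : ℂ) :
    ‖(u : ℂ) ^ (-s)‖ = u ^ (-s.re) := by
  rw [norm_cpow_eq_rpow_re_of_pos hu, neg_re]

theorem hasDerivAt_ofReal_cpow_neg {u : ℝ} (hu : 0 < u) (s : ℂ) :
    HasDerivAt (fun v : ℝ => (v : ℂ) ^ (-s)) (-s * (u : ℂ) ^ (-s - 1)) u := by
  have h := (hasDerivAt_id (u : ℂ)).cpow_const (c := -s) (Or.inl (by simpa using hu))
  simpa using h.comp_ofReal

theorem hasDerivAt_ofReal_cpow_one_sub_div {u : ℝ} (hu : 0 < u) {s : ℂ} (hs : s ≠ 1) :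
    HasDerivAt (fun v : ℝ => (v : ℂ) ^ (1 - s) / (1 - s)) ((u : ℂ) ^ (-s)) u := by
  have h := ((hasDerivAt_id (u : ℂ)).cpow_const (c := 1 - s)
    (Or.inl (by simpa using hu))).comp_ofReal.div_const (1 - s)
  have hs' : 1 - s ≠ 0 := sub_ne_zero.2 hs.symm
  convert! h using 1
  simp only [id, mul_one]
  rw [mul_div_cancel_left₀ _ hs']
  congr 1; ring

/-- With N = n + 1, `zetaTerm n s` is the increment over [N, N+1] of u N^{-s} - u^{1-s}/(1-s), so
the mean value inequality applies. -/
theorem norm_zetaTerm_le_of_deriv_le {s : ℂ} (hs : s ≠ 1) (n : ℕ) {C : ℝ}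
    (hC : ∀ u ∈ Icc ((n : ℝ) + 1) (n + 2),
      ‖(((n : ℝ) + 1 : ℝ) : ℂ) ^ (-s) - (u : ℂ) ^ (-s)‖ ≤ C) : ‖zetaTerm n s‖ ≤ C := by
  have h := (convex_Icc ((n : ℝ) + 1) (n + 2)).norm_image_sub_le_of_norm_hasDerivWithin_le
    (f := fun u : ℝ => (((n : ℝ) + 1 : ℝ) : ℂ) ^ (-s) * (u : ℂ) - (u : ℂ) ^ (1 - s) / (1 - s))
    (f' := fun u : ℝ => (((n : ℝ) + 1 : ℝ) : ℂ) ^ (-s) - (u : ℂ) ^ (-s)) (C := C)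
    (fun u hu => by
      have hu0 : 0 < u := lt_of_lt_of_le (by positivity) hu.1
      have h1 : HasDerivAt (fun u : ℝ => (u : ℂ)) 1 u := (hasDerivAt_id u).ofReal_comp
      have h2 := (h1.const_mul ((((n : ℝ) + 1 : ℝ) : ℂ) ^ (-s))).sub
        (hasDerivAt_ofReal_cpow_one_sub_div hu0 hs)
      rw [mul_one] at h2
      exact h2.hasDerivWithinAt) hC
    (left_mem_Icc.2 (by linarith)) (right_mem_Icc.2 (by linarith))
  rw [show ((n : ℝ) + 2 - (n + 1)) = 1 by ring, norm_one, mul_one] at h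
  refine le_trans (le_of_eq ?_) h
  rw [zetaTerm]
  congr 1
  push_cast
  ring

/-- Interpolation, with exponent 2r, between the trivial bound 2N^{-σ} and the derivative bound |s|
N^{-σ-1}. For σ ≥ 1 - r the result is summable in N and costs only |s|^{2r}, an arbitrarily small
power. -/
theorem norm_zetaTerm_le {r : ℝ} (hr0 : 0 < r) (hr1 : r ≤ 1 / 2) {s : ℂ} (hs : s ≠ 1)
    (hre : 1 - r ≤ s.re) (n : ℕ) :
    ‖zetaTerm n s‖ ≤ 2 * ‖s‖ ^ (2 * r) * ((n : ℝ) + 1) ^ (-(1 + r)) := by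
  have hN : (0 : ℝ) < (n : ℝ) + 1 := by positivity
  set N : ℝ := (n : ℝ) + 1 with hNdef
  have hσ : 0 < s.re := by linarith
  have hA : 0 < N ^ (-s.re) := Real.rpow_pos_of_pos hN _
  have hmono : ∀ u ∈ Icc N (n + 2), u ^ (-s.re) ≤ N ^ (-s.re) := fun u hu =>
    Real.rpow_le_rpow_of_nonpos hN hu.1 (by linarith)
  have h1 : ‖zetaTerm n s‖ ≤ 2 * N ^ (-s.re) :=
    norm_zetaTerm_le_of_deriv_le hs n fun u hu => by
      have hu0 : 0 < u := lt_of_lt_of_le hN hu.1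
      refine (norm_sub_le _ _).trans ?_
      rw [← hNdef, norm_ofReal_cpow_neg hN, norm_ofReal_cpow_neg hu0]
      linarith [hmono u hu]
  have h2 : ‖zetaTerm n s‖ ≤ N ^ (-s.re) * (‖s‖ / N) :=
    norm_zetaTerm_le_of_deriv_le hs n fun u hu => by
      have h := (convex_Icc N (n + 2)).norm_image_sub_le_of_norm_hasDerivWithin_le
        (f := fun v : ℝ => (v : ℂ) ^ (-s)) (f' := fun v : ℝ => -s * (v : ℂ) ^ (-s - 1))
        (C := N ^ (-s.re) * (‖s‖ / N))
        (fun v hv => (hasDerivAt_ofReal_cpow_neg (lt_of_lt_of_le hN hv.1) s).hasDerivWithinAt)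
        (fun v hv => by
          have hv0 : 0 < v := lt_of_lt_of_le hN hv.1
          rw [norm_mul, norm_neg, norm_cpow_eq_rpow_re_of_pos hv0]
          simp only [sub_re, neg_re, one_re]
          rw [Real.rpow_sub_one hv0.ne', mul_comm, div_mul_eq_mul_div, mul_div_assoc]
          exact mul_le_mul (hmono v hv) (div_le_div_of_nonneg_left (norm_nonneg _) hN hv.1)
            (by positivity) hA.le)
        hu (left_mem_Icc.2 (by rw [hNdef]; linarith))
      rw [← hNdef]
      refine h.trans (mul_le_of_le_one_right (by positivity) ?_)
      rw [Real.norm_eq_abs, abs_le]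
      constructor <;> linarith [hu.1, hu.2]
  have h3 : ‖zetaTerm n s‖ ≤ 2 * N ^ (-s.re) * (‖s‖ / N) ^ (2 * r) := by
    rcases le_total 1 (‖s‖ / N) with h | h
    · refine h1.trans (le_mul_of_one_le_right (by positivity) ?_)
      exact Real.one_le_rpow h (by positivity)
    · refine h2.trans ?_
      have h4 : ‖s‖ / N ≤ (‖s‖ / N) ^ (2 * r) := by
        rcases (show 0 ≤ ‖s‖ / N by positivity).eq_or_lt with h0 | h0
        · rw [← h0]; positivity
        · simpa using Real.rpow_le_rpow_of_exponent_ge h0 h (show 2 * r ≤ 1 by linarith)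
      calc N ^ (-s.re) * (‖s‖ / N) ≤ N ^ (-s.re) * (‖s‖ / N) ^ (2 * r) := by gcongr
        _ ≤ 2 * N ^ (-s.re) * (‖s‖ / N) ^ (2 * r) := by
          have : 0 ≤ N ^ (-s.re) * (‖s‖ / N) ^ (2 * r) := by positivity
          linarith
  refine h3.trans ?_
  rw [Real.div_rpow (norm_nonneg _) hN.le]
  have h5 : N ^ (-s.re) / N ^ (2 * r) ≤ N ^ (-(1 + r)) := by
    rw [← Real.rpow_sub hN]
    exact Real.rpow_le_rpow_of_exponent_le (by rw [hNdef]; linarith [n.cast_nonneg (α := ℝ)])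
      (by linarith)
  calc 2 * N ^ (-s.re) * (‖s‖ ^ (2 * r) / N ^ (2 * r))
      = 2 * ‖s‖ ^ (2 * r) * (N ^ (-s.re) / N ^ (2 * r)) := by ring
    _ ≤ _ := by gcongr

theorem summable_nat_add_one_rpow_neg {r : ℝ} (hr0 : 0 < r) :
    Summable fun n : ℕ => ((n : ℝ) + 1) ^ (-(1 + r)) := by
  have := (summable_nat_add_iff 1).2 (Real.summable_nat_rpow.2 (show -(1 + r) < -1 by linarith))
  simpa using this

theorem summable_zetaTerm {r : ℝ} (hr0 : 0 < r) (hr1 : r ≤ 1 / 2) {s : ℂ} (hs : s ≠ 1)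
    (hre : 1 - r ≤ s.re) : Summable fun n => zetaTerm n s :=
  Summable.of_norm_bounded ((summable_nat_add_one_rpow_neg hr0).mul_left _)
    (norm_zetaTerm_le hr0 hr1 hs hre)

theorem norm_zetaRest_le {r : ℝ} (hr0 : 0 < r) (hr1 : r ≤ 1 / 2) {s : ℂ} (hs : s ≠ 1)
    (hre : 1 - r ≤ s.re) :
    ‖zetaRest s‖ ≤ 2 * (∑' n : ℕ, ((n : ℝ) + 1) ^ (-(1 + r))) * ‖s‖ ^ (2 * r) := by
  have h := tsum_of_norm_bounded ((summable_nat_add_one_rpow_neg hr0).mul_left _).hasSum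
    (norm_zetaTerm_le hr0 hr1 hs hre)
  rw [tsum_mul_left] at h
  refine h.trans (le_of_eq (by ring))

theorem differentiableAt_zetaTerm (n : ℕ) {s : ℂ} (hs : s ≠ 1) :
    DifferentiableAt ℂ (zetaTerm n) s := by
  have h1 : (n : ℂ) + 1 ≠ 0 := by exact_mod_cast n.succ_ne_zero
  have h2 : (n : ℂ) + 2 ≠ 0 := by exact_mod_cast (n + 1).succ_ne_zero
  have h3 : 1 - s ≠ 0 := sub_ne_zero.2 hs.symm
  unfold zetaTerm
  fun_prop (disch := first | assumption | simp [*])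

theorem differentiableAt_zetaRest {s : ℂ} (hs : s ≠ 1) (hre : 1 / 2 < s.re) :
    DifferentiableAt ℂ zetaRest s := by
  set U : Set ℂ := {z | 1 / 2 < z.re} ∩ {z | ‖z‖ < ‖s‖ + 1} ∩ {1}ᶜ with hU
  have hUo : IsOpen U := ((isOpen_lt continuous_const continuous_re).inter
    (isOpen_lt continuous_norm continuous_const)).inter isOpen_compl_singleton
  have hsU : s ∈ U := ⟨⟨hre, by simp⟩, hs⟩
  have h := differentiableOn_tsum_of_summable_norm (F := zetaTerm)
    (u := fun n : ℕ => 2 * (‖s‖ + 1) ^ (2 * (1 / 2 : ℝ)) * ((n : ℝ) + 1) ^ (-(1 + 1 / 2 : ℝ)))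
    ((summable_nat_add_one_rpow_neg (by norm_num)).mul_left _)
    (fun n z hz => (differentiableAt_zetaTerm n hz.2).differentiableWithinAt) hUo
    (fun n z hz => by
      refine (norm_zetaTerm_le (r := 1 / 2) (by norm_num) le_rfl hz.2
        (by have : 1 / 2 < z.re := hz.1.1; linarith) n).trans ?_
      have : ‖z‖ ≤ ‖s‖ + 1 := le_of_lt hz.1.2
      gcongr)
  exact (h s hsU).differentiableAt (hUo.mem_nhds hsU)

theorem riemannZeta_eq_zetaRest {s : ℂ} (hs : 1 < s.re) :
    riemannZeta s = 1 / (s - 1) + zetaRest s := by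
  have hs1 : s ≠ 1 := fun h => by simp [h] at hs
  have hsub : 1 - s ≠ 0 := sub_ne_zero.2 hs1.symm
  have hsum := (summable_zetaTerm (r := 1 / 2) (by norm_num) le_rfl hs1 (by linarith)).hasSum
  have hz : Summable fun n : ℕ => ((n : ℂ) + 1) ^ (-s) := by
    have := (summable_nat_add_iff 1).2 (summable_one_div_nat_cpow.2 hs)
    simpa [cpow_neg] using this
  have hz' : riemannZeta s = ∑' n : ℕ, ((n : ℂ) + 1) ^ (-s) := by
    rw [zeta_eq_tsum_one_div_nat_add_one_cpow hs]
    simp [cpow_neg]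
  have hpow : Tendsto (fun N : ℕ => ((N : ℂ) + 1) ^ (1 - s)) atTop (𝓝 0) := by
    rw [tendsto_zero_iff_norm_tendsto_zero]
    have e : ∀ N : ℕ, ‖((N : ℂ) + 1) ^ (1 - s)‖ = ((N : ℝ) + 1) ^ (-(s.re - 1)) := fun N => by
      have h0 : (0 : ℝ) < (N : ℝ) + 1 := by positivity
      have := norm_cpow_eq_rpow_re_of_pos h0 (1 - s)
      push_cast at this
      rw [this]; simp
    simp only [e]
    exact (tendsto_rpow_neg_atTop (by linarith)).comp
      (tendsto_atTop_add_const_right _ _ tendsto_natCast_atTop_atTop)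
  have hpart : ∀ N : ℕ, ∑ n ∈ Finset.range N, zetaTerm n s =
      ∑ n ∈ Finset.range N, ((n : ℂ) + 1) ^ (-s) -
        (((N : ℂ) + 1) ^ (1 - s) - 1) / (1 - s) := by
    intro N
    induction N with
    | zero => simp
    | succ N ih =>
      rw [Finset.sum_range_succ, Finset.sum_range_succ, ih, zetaTerm]
      push_cast
      rw [show (N : ℂ) + 1 + 1 = N + 2 by ring]
      ring
  have h1 := hsum.tendsto_sum_nat
  simp only [hpart] at h1
  have h2 := hz.hasSum.tendsto_sum_nat.sub ((hpow.sub_const 1).div_const (1 - s))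
  have h3 := tendsto_nhds_unique h1 h2
  rw [hz', zetaRest, h3]
  have : s - 1 ≠ 0 := sub_ne_zero.2 hs1
  field_simp
  ring

end

/-! ### Upper and lower bounds for ζ near Re s = 1. -/

section

open Set Filter Topology Complex

theorem two_mul_tsum_nat_add_one_rpow_neg_nonneg (r : ℝ) :
    0 ≤ 2 * (∑' n : ℕ, ((n : ℝ) + 1) ^ (-(1 + r))) := by
  have : 0 ≤ ∑' n : ℕ, ((n : ℝ) + 1) ^ (-(1 + r)) := tsum_nonneg fun n => by positivity
  positivity

theorem ne_one_of_im_ne_zero {s : ℂ} (h : s.im ≠ 0) : s ≠ 1 := fun e => h (by simp [e])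

/-- Bounds for `ζ` and `ζ'` just to the right of the line `Re s = 1`. -/
theorem exists_riemannZeta_bound {r : ℝ} (hr0 : 0 < r) (hr1 : r ≤ 1 / 2) :
    ∃ A : ℝ, 1 ≤ A ∧ ∀ s : ℂ, 1 < s.re → s.re ≤ 2 → 1 ≤ |s.im| →
      ‖riemannZeta s‖ ≤ A * |s.im| ^ (2 * r) ∧ ‖deriv riemannZeta s‖ ≤ A * |s.im| ^ (2 * r) := by
  set K := 2 * (∑' n : ℕ, ((n : ℝ) + 1) ^ (-(1 + r))) with hK
  have hK0 : 0 ≤ K := two_mul_tsum_nat_add_one_rpow_neg_nonneg r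
  refine ⟨1 + 8 * K / r, by have : 0 ≤ 8 * K / r := by positivity
                            linarith, fun s h1 h2 h3 => ?_⟩
  set t := |s.im| with ht
  have hT : 1 ≤ t ^ (2 * r) := Real.one_le_rpow h3 (by positivity)
  have hs1 : s ≠ 1 := ne_one_of_im_ne_zero fun h => by
    rw [ht, h, abs_zero] at h3; linarith
  have hns : ‖s‖ ≤ 3 * t := by
    refine (norm_le_abs_re_add_abs_im s).trans ?_
    rw [abs_of_pos (by linarith)]; linarith
  -- The disc of radius r/2 about s stays in Re z > 1 - r and misses the pole because |Im s| ≥ 1.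
  -- Cauchy's estimate on it bounds the derivative, whence 8K/r = 4K/(r/2).
  have hrest : ∀ z : ℂ, ‖z - s‖ ≤ r / 2 → z ≠ 1 ∧ 1 - r < z.re ∧
      ‖zetaRest z‖ ≤ 4 * K * t ^ (2 * r) := by
    intro z hz
    have him := (abs_im_le_norm (z - s)).trans hz
    have hre := (abs_re_le_norm (z - s)).trans hz
    rw [sub_im] at him
    rw [sub_re] at hre
    have hz1 : z ≠ 1 := ne_one_of_im_ne_zero fun h => by
      rw [h, zero_sub, abs_neg, ← ht] at him; linarith
    have hzre : 1 - r < z.re := by linarith [(abs_le.1 hre).1]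
    refine ⟨hz1, hzre, (norm_zetaRest_le hr0 hr1 hz1 hzre.le).trans ?_⟩
    have hzn : ‖z‖ ≤ 4 * t := by
      have := norm_le_norm_add_norm_sub s z
      rw [norm_sub_rev] at this
      linarith
    have h4 : (4 : ℝ) ^ (2 * r) ≤ 4 := by
      simpa using Real.rpow_le_rpow_of_exponent_le (show (1 : ℝ) ≤ 4 by norm_num)
        (show 2 * r ≤ 1 by linarith)
    calc K * ‖z‖ ^ (2 * r) ≤ K * (4 * t) ^ (2 * r) := by gcongr
      _ = K * ((4 : ℝ) ^ (2 * r) * t ^ (2 * r)) := by rw [Real.mul_rpow (by norm_num) (by linarith)]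
      _ ≤ K * (4 * t ^ (2 * r)) := by gcongr
      _ = _ := by ring
  have hinv : ‖1 / (s - 1)‖ ≤ 1 := by
    rw [norm_div, norm_one, one_div]
    refine inv_le_one_of_one_le₀ (h3.trans ?_)
    simpa [ht] using abs_im_le_norm (s - 1)
  have hKr : 4 * K ≤ 8 * K / r := by
    rw [le_div_iff₀ hr0]; nlinarith
  constructor
  · rw [riemannZeta_eq_zetaRest h1]
    refine (norm_add_le _ _).trans ?_
    have := (hrest s (by simp; positivity)).2.2
    have h5 : 4 * K * t ^ (2 * r) ≤ 8 * K / r * t ^ (2 * r) := by gcongr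
    linarith
  · have hev : riemannZeta =ᶠ[𝓝 s] fun z => 1 / (z - 1) + zetaRest z := by
      filter_upwards [(isOpen_lt continuous_const continuous_re).mem_nhds h1] with z hz
      exact riemannZeta_eq_zetaRest hz
    have hd1 : HasDerivAt (fun z : ℂ => 1 / (z - 1)) (-(1 / (s - 1)) ^ 2) s := by
      have h := ((hasDerivAt_id s).sub_const 1).inv (sub_ne_zero.2 hs1)
      simp only [one_div]
      convert! h using 1
      simp; ring
    have hd2 := (differentiableAt_zetaRest hs1 (by linarith)).hasDerivAt
    rw [hev.deriv_eq, (hd1.fun_add hd2).deriv]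
    have hd3 : ‖deriv zetaRest s‖ ≤ 4 * K * t ^ (2 * r) / (r / 2) := by
      refine norm_deriv_le_of_forall_mem_sphere_norm_le (by positivity) ?_ fun z hz => ?_
      · refine DifferentiableOn.diffContOnCl fun z hz => ?_
        have hz' := hrest z (by
          simpa [dist_eq_norm] using Metric.closure_ball_subset_closedBall hz)
        exact (differentiableAt_zetaRest hz'.1 (by linarith [hz'.2.1])).differentiableWithinAt
      · exact (hrest z (by rw [mem_sphere_iff_norm] at hz; exact hz.le)).2.2
    refine (norm_add_le _ _).trans ?_
    rw [norm_neg, norm_pow]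
    have h6 : ‖1 / (s - 1)‖ ^ 2 ≤ 1 := pow_le_one₀ (norm_nonneg _) hinv
    have h7 : 4 * K * t ^ (2 * r) / (r / 2) = 8 * K / r * t ^ (2 * r) := by field_simp; ring
    rw [h7] at hd3
    linarith

theorem exists_riemannZeta_one_add_bound :
    ∃ B : ℝ, 1 ≤ B ∧ ∀ x : ℝ, 0 < x → x ≤ 1 → ‖riemannZeta (1 + x)‖ ≤ B / x := by
  set K := 2 * (∑' n : ℕ, ((n : ℝ) + 1) ^ (-(1 + 1 / 2 : ℝ))) with hK
  have hK0 : 0 ≤ K := two_mul_tsum_nat_add_one_rpow_neg_nonneg _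
  refine ⟨1 + 2 * K, by linarith, fun x hx hx1 => ?_⟩
  have h1 : (1 + (x : ℂ)) ≠ 1 := by simpa using hx.ne'
  rw [riemannZeta_eq_zetaRest (by simpa using hx)]
  refine (norm_add_le _ _).trans ?_
  have h2 := norm_zetaRest_le (r := 1 / 2) (by norm_num) le_rfl h1 (by simp; linarith)
  have h3 : ‖(1 + (x : ℂ))‖ ≤ 2 := by
    refine (norm_add_le _ _).trans ?_
    simp [abs_of_pos hx]; linarith
  have h4 : ‖zetaRest (1 + x)‖ ≤ K * 2 := by
    rw [← hK, show (2 * (1 / 2) : ℝ) = 1 by norm_num, Real.rpow_one] at h2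
    exact h2.trans (by gcongr)
  have h5 : ‖1 / (1 + (x : ℂ) - 1)‖ = 1 / x := by simp [abs_of_pos hx]
  rw [h5, add_div]
  have h6 : 2 * K ≤ 2 * K / x := le_div_self (by positivity) hx hx1
  linarith

theorem norm_riemannZeta_product_ge_one {x : ℝ} (hx : 0 < x) (t : ℝ) :
    1 ≤ ‖riemannZeta (1 + x)‖ ^ 3 * ‖riemannZeta (1 + x + I * t)‖ ^ 4 *
      ‖riemannZeta (1 + x + 2 * I * t)‖ := by
  have h := DirichletCharacter.norm_LFunction_product_ge_one
    (1 : DirichletCharacter ℂ 1) hx t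
  simpa [DirichletCharacter.LFunctionTrivChar, DirichletCharacter.LFunction_modOne_eq] using h

/-- A lower bound for `ζ` just to the right of the line `Re s = 1`. -/
theorem exists_riemannZeta_lower_bound {r : ℝ} (hr0 : 0 < r) (hr1 : r ≤ 1 / 2) :
    ∃ c : ℝ, 0 < c ∧ ∀ s : ℂ, 1 < s.re → s.re ≤ 2 → 1 ≤ |s.im| →
      c ≤ ‖riemannZeta s‖ * (|s.im| ^ (2 * r)) ^ 4 := by
  obtain ⟨A, hA1, hA⟩ := exists_riemannZeta_bound hr0 hr1
  obtain ⟨B, hB1, hB⟩ := exists_riemannZeta_one_add_bound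
  set D := 2 * A * B ^ 3 with hD
  have hD1 : 1 ≤ D := by
    have : 1 ≤ B ^ 3 := one_le_pow₀ hB1
    nlinarith
  -- Chosen so that D · 16A⁴ · c₁ = 1, which balances the 3-4-1 inequality at distance c₁/T⁵ from
  -- the line Re s = 1.
  set c₁ := 1 / (16 * A ^ 4 * D) with hc₁
  have hc₁0 : 0 < c₁ := by positivity
  have hc₁1 : c₁ ≤ 1 := by
    rw [hc₁, div_le_one (by positivity)]
    have : 1 ≤ A ^ 4 := one_le_pow₀ hA1
    nlinarith
  refine ⟨c₁ * A, by positivity, fun s h1 h2 h3 => ?_⟩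
  set τ := s.im with hτ
  set T := |τ| ^ (2 * r) with hTdef
  have hT1 : 1 ≤ T := Real.one_le_rpow h3 (by positivity)
  have hT0 : 0 < T := by linarith
  -- At distance at least c₁/T⁵ from the line the 3-4-1 inequality gives twice the wanted bound.
  -- Closer in, moving out to that distance changes ζ by at most A T · c₁/T⁵, which is half of it.
  have hlow : ∀ x : ℝ, 0 < x → x ≤ 1 → c₁ / T ^ 5 ≤ x →
      2 * (c₁ * A / T ^ 4) ≤ ‖riemannZeta (1 + x + I * τ)‖ := by
    intro x hx hx1 hxη
    have h4 := norm_riemannZeta_product_ge_one hx τ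
    have h5 := hB x hx hx1
    have h6 : ‖riemannZeta (1 + x + 2 * I * τ)‖ ≤ 2 * A * T := by
      have h7 := (hA (1 + x + 2 * I * τ) (by simp; linarith) (by simp; linarith)
        (by simp [abs_mul]; linarith)).1
      have h8 : (1 + x + 2 * I * τ : ℂ).im = 2 * τ := by simp
      rw [h8, abs_mul, abs_two, Real.mul_rpow (by norm_num) (abs_nonneg _)] at h7
      have h9 : (2 : ℝ) ^ (2 * r) ≤ 2 := by
        simpa using Real.rpow_le_rpow_of_exponent_le (show (1 : ℝ) ≤ 2 by norm_num)
          (show 2 * r ≤ 1 by linarith)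
      refine h7.trans ?_
      calc A * ((2 : ℝ) ^ (2 * r) * T) ≤ A * (2 * T) := by gcongr
        _ = _ := by ring
    set w := ‖riemannZeta (1 + x + I * τ)‖ with hw
    have hw0 : 0 ≤ w := norm_nonneg _
    have h10 : x ^ 3 ≤ D * T * w ^ 4 := by
      have : 1 ≤ (B / x) ^ 3 * w ^ 4 * (2 * A * T) := h4.trans (by gcongr)
      rw [div_pow, div_mul_eq_mul_div, div_mul_eq_mul_div, le_div_iff₀ (by positivity)] at this
      rw [hD]; linarith
    have h11 : D * T * (2 * (c₁ * A / T ^ 4)) ^ 4 ≤ D * T * w ^ 4 := by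
      refine le_trans (le_of_eq ?_) ((pow_le_pow_left₀ (by positivity) hxη 3).trans h10)
      have h12 : D * (16 * A ^ 4 * c₁) = 1 := by rw [hc₁]; field_simp
      calc D * T * (2 * (c₁ * A / T ^ 4)) ^ 4
          = (D * (16 * A ^ 4 * c₁)) * (c₁ ^ 3 * T / T ^ 16) := by
            simp only [mul_pow, div_pow]; ring
        _ = (c₁ / T ^ 5) ^ 3 := by rw [h12]; field_simp
    exact (pow_le_pow_iff_left₀ (by positivity) hw0 (by norm_num)).1
      (le_of_mul_le_mul_left h11 (by positivity))
  have hs : s = 1 + ((s.re - 1 : ℝ) : ℂ) + I * τ := by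
    apply Complex.ext <;> simp [hτ]
  have hmain : c₁ * A / T ^ 4 ≤ ‖riemannZeta s‖ := by
    have hy : 0 < c₁ * A / T ^ 4 := by positivity
    rcases le_total (c₁ / T ^ 5) (s.re - 1) with h | h
    · have := hlow (s.re - 1) (by linarith) (by linarith) h
      rw [← hs] at this
      linarith
    · have hη0 : 0 < c₁ / T ^ 5 := by positivity
      have hη1 : c₁ / T ^ 5 ≤ 1 := by
        rw [div_le_one (by positivity)]
        exact hc₁1.trans (one_le_pow₀ hT1)
      have h4 := hlow (c₁ / T ^ 5) hη0 hη1 le_rfl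
      have h5 := (convex_Icc (s.re - 1) (c₁ / T ^ 5)).norm_image_sub_le_of_norm_hasDerivWithin_le
        (f := fun u : ℝ => riemannZeta (1 + u + I * τ))
        (f' := fun u : ℝ => deriv riemannZeta (1 + u + I * τ)) (C := A * T)
        (fun u hu => by
          have hu0 : 0 < u := by linarith [hu.1]
          have hne : (1 + u + I * τ : ℂ) ≠ 1 := fun h => by
            have := congrArg re h
            simp at this; linarith
          have hd := (differentiableAt_riemannZeta hne).hasDerivAt
          have h6 : HasDerivAt (fun u : ℂ => 1 + u + I * τ) 1 (u : ℂ) :=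
            ((hasDerivAt_id (u : ℂ)).const_add 1).add_const _
          have h7 := (HasDerivAt.comp (u : ℂ) hd h6).comp_ofReal
          rw [mul_one] at h7
          exact h7.hasDerivWithinAt)
        (fun u hu => by
          have := (hA (1 + u + I * τ) (by simp; linarith [hu.1]) (by simp; linarith [hu.2])
            (by simpa using h3)).2
          simpa using this)
        (left_mem_Icc.2 h) (right_mem_Icc.2 h)
      rw [← hs] at h5
      have h6 : A * T * ‖c₁ / T ^ 5 - (s.re - 1)‖ ≤ c₁ * A / T ^ 4 := by
        rw [Real.norm_of_nonneg (by linarith)]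
        calc A * T * (c₁ / T ^ 5 - (s.re - 1)) ≤ A * T * (c₁ / T ^ 5) := by gcongr; linarith
          _ = c₁ * A / T ^ 4 := by field_simp
      have h7 := norm_le_norm_add_norm_sub (riemannZeta s)
        (riemannZeta (1 + ((c₁ / T ^ 5 : ℝ) : ℂ) + I * τ))
      rw [norm_sub_rev] at h7
      linarith
  rwa [div_le_iff₀ (by positivity)] at hmain

end

/-! ### The derivative of 1/(s ζ(s)) up to Re s = 1. -/

section

open Set Filter Topology Complex

/-- The Mellin-type transform `1 / (s ζ(s))` of the Mertens function. -/
noncomputable def invMulZeta (s : ℂ) : ℂ := 1 / (s * riemannZeta s)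

theorem hasDerivAt_invMulZeta {s : ℂ} (hs : 1 ≤ s.re) (h1 : s ≠ 1) :
    HasDerivAt invMulZeta
      (-(riemannZeta s + s * deriv riemannZeta s) / (s * riemannZeta s) ^ 2) s := by
  have hs0 : s ≠ 0 := fun h => by simp [h] at hs; linarith
  have h := ((hasDerivAt_id s).mul (differentiableAt_riemannZeta h1).hasDerivAt).inv
    (mul_ne_zero hs0 (riemannZeta_ne_zero_of_one_le_re hs))
  have e : invMulZeta = fun z => (z * riemannZeta z)⁻¹ := by funext z; simp [invMulZeta]
  rw [e]
  convert! h using 1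
  simp

/-- The derivative is O(T⁹/t): 1/ζ costs T⁴ and enters squared, ζ' costs T. With r = 1/72, T⁹ =
t^{1/4}, and the square of t^{-3/4} is integrable at infinity. -/
theorem exists_deriv_invMulZeta_bound_of_one_le_abs_im :
    ∃ C : ℝ, ∀ s : ℂ, 1 < s.re → s.re ≤ 2 → 1 ≤ |s.im| →
      ‖deriv invMulZeta s‖ ≤ C * |s.im| ^ (-(3 / 4) : ℝ) := by
  obtain ⟨A, hA1, hA⟩ := exists_riemannZeta_bound (r := 1 / 72) (by norm_num) (by norm_num)
  obtain ⟨c, hc0, hc⟩ := exists_riemannZeta_lower_bound (r := 1 / 72) (by norm_num) (by norm_num)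
  refine ⟨1 / c + A / c ^ 2, fun s h1 h2 h3 => ?_⟩
  obtain ⟨hz, hz'⟩ := hA s h1 h2 h3
  have hl := hc s h1 h2 h3
  set t := |s.im| with ht
  have ht0 : 0 < t := by linarith
  set T := t ^ (2 * (1 / 72) : ℝ) with hT
  have hT1 : 1 ≤ T := Real.one_le_rpow h3 (by norm_num)
  have hT9 : T ^ 9 = t ^ (1 / 4 : ℝ) := by
    rw [hT, ← Real.rpow_natCast, ← Real.rpow_mul ht0.le]; norm_num
  have hs1 : s ≠ 1 := ne_one_of_im_ne_zero fun h => by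
    rw [ht, h, abs_zero] at h3; linarith
  have hts : t ≤ ‖s‖ := abs_im_le_norm s
  have hs0 : 0 < ‖s‖ := by linarith
  set z := ‖riemannZeta s‖ with hzdef
  have hz0 : 0 < z := norm_pos_iff.2 (riemannZeta_ne_zero_of_one_le_re h1.le)
  have hzinv : 1 / z ≤ T ^ 4 / c := by
    rw [div_le_div_iff₀ hz0 hc0]; linarith
  rw [(hasDerivAt_invMulZeta h1.le hs1).deriv, norm_div, norm_neg, norm_pow, norm_mul, ← hzdef]
  have e : (z + ‖s‖ * ‖deriv riemannZeta s‖) / (‖s‖ * z) ^ 2 =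
      1 / ‖s‖ ^ 2 * (1 / z) + 1 / ‖s‖ * ‖deriv riemannZeta s‖ * (1 / z) ^ 2 := by
    field_simp
  have hle : (1 : ℝ) / ‖s‖ ≤ 1 / t := one_div_le_one_div_of_le ht0 hts
  have hle2 : (1 : ℝ) / ‖s‖ ^ 2 ≤ 1 / t := by
    refine one_div_le_one_div_of_le ht0 ?_
    nlinarith
  calc ‖riemannZeta s + s * deriv riemannZeta s‖ / (‖s‖ * z) ^ 2
      ≤ (z + ‖s‖ * ‖deriv riemannZeta s‖) / (‖s‖ * z) ^ 2 := by
        gcongr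
        refine (norm_add_le _ _).trans ?_
        rw [norm_mul]
    _ = 1 / ‖s‖ ^ 2 * (1 / z) + 1 / ‖s‖ * ‖deriv riemannZeta s‖ * (1 / z) ^ 2 := e
    _ ≤ 1 / t * (T ^ 4 / c) + 1 / t * (A * T) * (T ^ 4 / c) ^ 2 := by gcongr
    _ = 1 / t * (T ^ 4 / c) + 1 / t * (A / c ^ 2 * T ^ 9) := by ring
    _ ≤ 1 / t * (T ^ 9 / c) + 1 / t * (A / c ^ 2 * T ^ 9) := by
        gcongr
        · norm_num
    _ = (1 / c + A / c ^ 2) * (T ^ 9 / t) := by ring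
    _ = (1 / c + A / c ^ 2) * t ^ (-(3 / 4) : ℝ) := by
        rw [hT9]
        nth_rewrite 2 [← Real.rpow_one t]
        rw [← Real.rpow_sub ht0]
        norm_num

/-- The pole of ζ becomes a zero of 1/(s ζ(s)): since (s-1)ζ(s) extends to an entire function
without zeros in Re s ≥ 1, compactness suffices. -/
theorem exists_deriv_invMulZeta_bound_of_abs_im_le_one :
    ∃ C : ℝ, ∀ s : ℂ, 1 < s.re → s.re ≤ 2 → |s.im| ≤ 1 → ‖deriv invMulZeta s‖ ≤ C := by
  set Z := DirichletCharacter.LFunctionTrivChar₁ 1 with hZ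
  have hZd : Differentiable ℂ Z := DirichletCharacter.differentiable_LFunctionTrivChar₁ 1
  have hZeq : ∀ s : ℂ, s ≠ 1 → Z s = (s - 1) * riemannZeta s := fun s hs => by
    rw [hZ, DirichletCharacter.LFunctionTrivChar₁, Function.update_of_ne hs,
      DirichletCharacter.LFunctionTrivChar, DirichletCharacter.LFunction_modOne_eq]
  have hZne : ∀ s : ℂ, 1 ≤ s.re → Z s ≠ 0 := fun s hs => by
    by_cases h : s = 1
    · rw [h]; exact DirichletCharacter.LFunctionTrivChar₁_apply_one_ne_zero 1
    · rw [hZeq s h]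
      exact mul_ne_zero (sub_ne_zero.2 h) (riemannZeta_ne_zero_of_one_le_re hs)
  set g : ℂ → ℂ := fun s => (s - 1) / (s * Z s) with hg
  set U : Set ℂ := {s | s * Z s ≠ 0} with hU
  have hUo : IsOpen U := isOpen_ne_fun (continuous_id.mul hZd.continuous) continuous_const
  have hgd : DifferentiableOn ℂ g U := fun s hs =>
    ((differentiableAt_id.sub_const 1).fun_div (d := fun z => z * Z z)
      (differentiableAt_id.fun_mul (hZd s)) hs).differentiableWithinAt
  have hgc : ContinuousOn (deriv g) U := (hgd.deriv hUo).continuousOn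
  have hKU : Icc (1 : ℝ) 2 ×ℂ Icc (-1 : ℝ) 1 ⊆ U := fun s hs => by
    have hs1 : 1 ≤ s.re := (mem_reProdIm.1 hs).1.1
    refine mul_ne_zero (fun h => ?_) (hZne s hs1)
    rw [h, zero_re] at hs1; linarith
  obtain ⟨C, hC⟩ := (isCompact_Icc.reProdIm isCompact_Icc).exists_bound_of_continuousOn
    (hgc.mono hKU)
  refine ⟨C, fun s h1 h2 h3 => ?_⟩
  have hev : invMulZeta =ᶠ[𝓝 s] g := by
    filter_upwards [(isOpen_lt continuous_const continuous_re).mem_nhds h1] with z hz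
    have hz : 1 < z.re := hz
    have hz1 : z ≠ 1 := fun h => by simp [h] at hz
    simp only [invMulZeta, hg, hZeq z hz1]
    have := sub_ne_zero.2 hz1
    field_simp
  rw [hev.deriv_eq]
  exact hC s (mem_reProdIm.2 ⟨⟨h1.le, h2⟩, abs_le.1 h3⟩)

/-- The majorant is integrable in Im s and independent of Re s, as the passage to Re s = 1 requires.
-/
theorem exists_deriv_invMulZeta_sq_bound :
    ∃ C : ℝ, ∀ s : ℂ, 1 < s.re → s.re ≤ 2 →
      ‖deriv invMulZeta s‖ ^ 2 ≤ C * (1 + s.im ^ 2) ^ (-(3 / 4) : ℝ) := by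
  obtain ⟨C₁, hC₁⟩ := exists_deriv_invMulZeta_bound_of_one_le_abs_im
  obtain ⟨C₂, hC₂⟩ := exists_deriv_invMulZeta_bound_of_abs_im_le_one
  refine ⟨2 * (C₁ ^ 2 + C₂ ^ 2), fun s h1 h2 => ?_⟩
  have hpow : (2 : ℝ)⁻¹ ≤ 2 ^ (-(3 / 4) : ℝ) := by
    rw [← Real.rpow_neg_one]
    exact Real.rpow_le_rpow_of_exponent_le (by norm_num) (by norm_num)
  rcases le_total 1 |s.im| with h | h
  · have hb := pow_le_pow_left₀ (norm_nonneg _) (hC₁ s h1 h2 h) 2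
    have ht0 : 0 < |s.im| := by linarith
    have e : (|s.im| ^ (-(3 / 4) : ℝ)) ^ 2 = (s.im ^ 2) ^ (-(3 / 4) : ℝ) := by
      rw [← sq_abs s.im, ← Real.rpow_natCast, ← Real.rpow_natCast, ← Real.rpow_mul ht0.le,
        ← Real.rpow_mul ht0.le, mul_comm]
    have h4 : (2 : ℝ)⁻¹ * (s.im ^ 2) ^ (-(3 / 4) : ℝ) ≤ (1 + s.im ^ 2) ^ (-(3 / 4) : ℝ) := by
      have hi : 1 ≤ s.im ^ 2 := by rw [← sq_abs]; exact one_le_pow₀ h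
      calc (2 : ℝ)⁻¹ * (s.im ^ 2) ^ (-(3 / 4) : ℝ)
          ≤ 2 ^ (-(3 / 4) : ℝ) * (s.im ^ 2) ^ (-(3 / 4) : ℝ) := by gcongr
        _ = (2 * s.im ^ 2) ^ (-(3 / 4) : ℝ) := by
          rw [Real.mul_rpow (by norm_num) (sq_nonneg _)]
        _ ≤ _ := Real.rpow_le_rpow_of_nonpos (by positivity) (by linarith) (by norm_num)
    rw [mul_pow, e] at hb
    have h5 : 0 ≤ (1 + s.im ^ 2) ^ (-(3 / 4) : ℝ) := by positivity
    nlinarith [mul_le_mul_of_nonneg_left h4 (sq_nonneg C₁), mul_nonneg (sq_nonneg C₂) h5]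
  · have hb := pow_le_pow_left₀ (norm_nonneg _) (hC₂ s h1 h2 h) 2
    have h4 : (2 : ℝ)⁻¹ ≤ (1 + s.im ^ 2) ^ (-(3 / 4) : ℝ) := by
      refine hpow.trans (Real.rpow_le_rpow_of_nonpos (by positivity) ?_ (by norm_num))
      have : s.im ^ 2 ≤ 1 := by rw [← sq_abs]; exact pow_le_one₀ (abs_nonneg _) h
      linarith
    nlinarith [mul_le_mul_of_nonneg_left h4 (sq_nonneg C₂), mul_nonneg (sq_nonneg C₁)
      (show 0 ≤ (1 + s.im ^ 2) ^ (-(3 / 4) : ℝ) by positivity)]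

end

/-! ### Mellin–Plancherel for the Mertens function. -/

section

open MeasureTheory Set Filter Topology Complex FourierTransform

/-- The Mertens function of a real argument, as a complex number. -/
noncomputable def mertensFloor (t : ℝ) : ℂ := (mertens ⌊t⌋₊ : ℂ)

theorem measurable_mertensFloor : Measurable mertensFloor :=
  Complex.measurable_ofReal.comp ((measurable_from_top (f := mertens)).comp Nat.measurable_floor)

theorem norm_mertensFloor_le {t : ℝ} (ht : 0 ≤ t) : ‖mertensFloor t‖ ≤ t := by
  rw [mertensFloor, norm_real, Real.norm_eq_abs]
  exact (abs_mertens_le _).trans (Nat.floor_le ht)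

theorem mertensFloor_eq_zero {t : ℝ} (ht : t < 1) : mertensFloor t = 0 := by
  rw [mertensFloor, Nat.floor_eq_zero.2 ht]; simp

theorem mellin_mertensFloor {s : ℂ} (hs : 1 < s.re) : mellin mertensFloor (-s) = invMulZeta s := by
  have hsum : ∀ t : ℝ, ∑ k ∈ Finset.Icc 1 ⌊t⌋₊, ((ArithmeticFunction.moebius k : ℤ) : ℂ) =
      mertensFloor t := fun t => by
    simp [mertensFloor, mertens]
  have hL := LSeries_eq_mul_integral (fun n => ((ArithmeticFunction.moebius n : ℤ) : ℂ))
    zero_le_one hs (ArithmeticFunction.LSeriesSummable_moebius_iff.2 hs) (by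
      refine Asymptotics.IsBigO.of_bound 1 (Eventually.of_forall fun n => ?_)
      have := abs_mertens_le n
      rw [Real.rpow_one, one_mul, Real.norm_natCast]
      refine le_trans (le_of_eq ?_) this
      rw [← Real.norm_eq_abs, ← norm_real, mertens]
      simp)
  have hne : s ≠ 0 := fun h => by rw [h, zero_re] at hs; linarith
  have h1 : mellin mertensFloor (-s) = ∫ t in Ioi (1 : ℝ), mertensFloor t * (t : ℂ) ^ (-(s + 1)) := by
    rw [mellin, ← integral_Ici_eq_integral_Ioi (x := (1 : ℝ))]
    have : ∀ t : ℝ, (t : ℂ) ^ (-s - 1) • mertensFloor t =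
        mertensFloor t * (t : ℂ) ^ (-(s + 1)) := fun t => by
      rw [smul_eq_mul, mul_comm, neg_add, sub_eq_add_neg]
    simp only [this]
    refine (setIntegral_eq_of_subset_of_forall_sdiff_eq_zero measurableSet_Ioi
      (fun t ht => mem_Ioi.2 (zero_lt_one.trans_le (mem_Ici.1 ht))) fun t ht => ?_)
    rw [mertensFloor_eq_zero (not_le.1 ht.2), zero_mul]
  have h2 := ArithmeticFunction.LSeries_zeta_mul_Lseries_moebius hs
  rw [ArithmeticFunction.LSeries_zeta_eq_riemannZeta hs] at h2
  simp only [hsum] at hL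
  rw [hL, ← h1] at h2
  rw [invMulZeta, eq_div_iff (mul_ne_zero hne (riemannZeta_ne_zero_of_one_lt_re hs))]
  linear_combination h2

/-- Differentiating the Mellin transform brings down log t, the extra factor that later yields
integrability and not just square-integrability. -/
theorem deriv_invMulZeta_eq_mellin {s : ℂ} (hs : 1 < s.re) :
    deriv invMulZeta s = -mellin (fun t => Real.log t • mertensFloor t) (-s) := by
  have hloc : LocallyIntegrableOn mertensFloor (Ioi 0) := by
    refine LocallyIntegrable.locallyIntegrableOn ?_ _
    refine (continuous_id.locallyIntegrable (X := ℝ)).mono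
      measurable_mertensFloor.aestronglyMeasurable (Eventually.of_forall fun t => ?_)
    rcases le_or_gt 0 t with h | h
    · simpa [abs_of_nonneg h] using norm_mertensFloor_le h
    · rw [mertensFloor_eq_zero (by linarith)]; simp
  have htop : mertensFloor =O[atTop] fun t : ℝ => t ^ (-(-1 : ℝ)) := by
    refine Asymptotics.IsBigO.of_bound 1 ?_
    filter_upwards [eventually_ge_atTop 0] with t ht
    simpa [abs_of_nonneg ht] using norm_mertensFloor_le ht
  -- M vanishes on (0, 1), so any exponent below Re(-s) serves.
  have hbot : mertensFloor =O[𝓝[>] 0] fun t : ℝ => t ^ (-(-s.re - 1)) := by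
    refine Asymptotics.IsBigO.of_bound 1 ?_
    have : ∀ᶠ t : ℝ in 𝓝[>] 0, t < 1 := nhdsWithin_le_nhds (gt_mem_nhds zero_lt_one)
    filter_upwards [this] with t ht
    rw [mertensFloor_eq_zero ht]; simp
  have hd := (mellin_hasDerivAt_of_isBigO_rpow (s := -s) hloc htop
    (by rw [neg_re]; linarith) hbot (by rw [neg_re]; linarith)).2
  have hev : invMulZeta =ᶠ[𝓝 s] fun z => mellin mertensFloor (-z) := by
    filter_upwards [(isOpen_lt continuous_const continuous_re).mem_nhds hs] with z hz
    exact (mellin_mertensFloor hz).symm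
  rw [hev.deriv_eq]
  have h2 := HasDerivAt.comp s hd (hasDerivAt_neg s)
  rw [mul_neg_one] at h2
  exact h2.deriv

/-- The function `-u M(e^{-u}) e^{σ u}`, whose Fourier transform is a derivative of
`1 / (s ζ(s))` on the line `Re s = σ`. -/
noncomputable def mertensExp (σ u : ℝ) : ℝ :=
  Real.exp (σ * u) * (-u * mertens ⌊Real.exp (-u)⌋₊)

theorem measurable_mertensExp (σ : ℝ) : Measurable (mertensExp σ) := by
  have : Measurable fun u : ℝ => mertens ⌊Real.exp (-u)⌋₊ :=
    (measurable_from_top (f := mertens)).comp (Nat.measurable_floor.comp (by fun_prop))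
  unfold mertensExp
  fun_prop

theorem fourier_mertensExp {σ : ℝ} (hσ : 1 < σ) (y : ℝ) :
    ‖𝓕 (fun u => (mertensExp σ u : ℂ)) y‖ = ‖deriv invMulZeta ⟨σ, -(2 * Real.pi * y)⟩‖ := by
  rw [deriv_invMulZeta_eq_mellin (by exact hσ), norm_neg, mellin_eq_fourier]
  have h1 : (-(⟨σ, -(2 * Real.pi * y)⟩ : ℂ)).im / (2 * Real.pi) = y := by
    simp only [neg_im, neg_neg]
    field_simp
  rw [h1]
  have h2 : (fun u : ℝ => (mertensExp σ u : ℂ)) = fun u : ℝ =>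
      Real.exp (-(-(⟨σ, -(2 * Real.pi * y)⟩ : ℂ)).re * u) •
        Real.log (Real.exp (-u)) • mertensFloor (Real.exp (-u)) := by
    funext u
    simp [mertensExp, mertensFloor]
  rw [h2]

theorem integrable_mertensExp {σ : ℝ} (hσ : 1 < σ) :
    Integrable fun u => (mertensExp σ u : ℂ) := by
  refine Integrable.ofReal ?_
  -- Half of the spare decay σ - 1 absorbs the factor -u; the other half leaves e^{δu}, integrable
  -- on u ≤ 0.
  set δ := (σ - 1) / 2 with hδ
  have hδ0 : 0 < δ := by rw [hδ]; linarith
  have hdom : Integrable ((Iic (0 : ℝ)).indicator fun u => 1 / δ * Real.exp (δ * u)) :=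
    (integrable_indicator_iff measurableSet_Iic).2 ((integrableOn_exp_mul_Iic hδ0 0).const_mul _)
  refine hdom.mono' (measurable_mertensExp σ).aestronglyMeasurable (Eventually.of_forall fun u => ?_)
  change ‖mertensExp σ u‖ ≤ _
  rcases le_or_gt u 0 with hu | hu
  · rw [indicator_of_mem (mem_Iic.2 hu), mertensExp, norm_mul, norm_mul, norm_neg,
      Real.norm_eq_abs, Real.norm_eq_abs, Real.norm_eq_abs, Real.abs_exp, abs_of_nonpos hu]
    have h1 : |mertens ⌊Real.exp (-u)⌋₊| ≤ Real.exp (-u) :=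
      (abs_mertens_le _).trans (Nat.floor_le (Real.exp_pos _).le)
    have h2 : δ * -u ≤ Real.exp (δ * -u) := by linarith [Real.add_one_le_exp (δ * -u)]
    have h3 : -u ≤ 1 / δ * Real.exp (δ * -u) := by
      rw [one_div_mul_eq_div, le_div_iff₀ hδ0]; linarith
    calc Real.exp (σ * u) * (-u * |mertens ⌊Real.exp (-u)⌋₊|)
        ≤ Real.exp (σ * u) * (1 / δ * Real.exp (δ * -u) * Real.exp (-u)) := by
          have := abs_nonneg (mertens ⌊Real.exp (-u)⌋₊)
          gcongr
      _ = 1 / δ * (Real.exp (σ * u) * Real.exp (δ * -u) * Real.exp (-u)) := by ring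
      _ = 1 / δ * Real.exp (δ * u) := by
          rw [← Real.exp_add, ← Real.exp_add]
          congr 2
          rw [hδ]; ring
  · rw [indicator_of_notMem (by simpa using hu), mertensExp,
      Nat.floor_eq_zero.2 (Real.exp_lt_one_iff.2 (by linarith))]
    simp

theorem exists_lintegral_mertensExp_le :
    ∃ B : ENNReal, B < ⊤ ∧ ∀ σ : ℝ, 1 < σ → σ ≤ 2 →
      ∫⁻ u, ‖(mertensExp σ u : ℂ)‖ₑ ^ 2 ≤ B := by
  obtain ⟨C, hC⟩ := exists_deriv_invMulZeta_sq_bound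
  have hint : Integrable fun y : ℝ => |C| * (1 + y ^ 2) ^ (-(3 / 4) : ℝ) := by
    have := (integrable_rpow_neg_one_add_norm_sq (E := ℝ) (μ := volume) (r := 3 / 2)
      (by simp; norm_num)).const_mul |C|
    simp only [Real.norm_eq_abs, sq_abs] at this
    convert! this using 4
    norm_num
  refine ⟨∫⁻ y, ENNReal.ofReal (|C| * (1 + y ^ 2) ^ (-(3 / 4) : ℝ)), ?_, fun σ h1 h2 => ?_⟩
  · exact hint.lintegral_lt_top
  have hb : ∀ y, ‖𝓕 (fun u => (mertensExp σ u : ℂ)) y‖ ^ 2 ≤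
      |C| * (1 + y ^ 2) ^ (-(3 / 4) : ℝ) := fun y => by
    rw [fourier_mertensExp h1]
    refine (hC ⟨σ, -(2 * Real.pi * y)⟩ h1 h2).trans ?_
    refine mul_le_mul (le_abs_self C) ?_ (by positivity) (abs_nonneg C)
    refine Real.rpow_le_rpow_of_nonpos (by positivity) ?_ (by norm_num)
    have : 1 ≤ (2 * Real.pi) ^ 2 := one_le_pow₀ (by linarith [Real.pi_gt_three])
    simp only
    nlinarith [sq_nonneg y]
  have hG := integrable_mertensExp h1
  have hcont : Continuous (𝓕 fun u => (mertensExp σ u : ℂ)) :=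
    VectorFourier.fourierIntegral_continuous Real.continuous_fourierChar
      (by exact continuous_inner) hG
  have hmem : MemLp (𝓕 fun u => (mertensExp σ u : ℂ)) 2 volume := by
    rw [memLp_two_iff_integrable_sq_norm hcont.aestronglyMeasurable]
    refine hint.mono' (hcont.norm.pow 2).aestronglyMeasurable (Eventually.of_forall fun y => ?_)
    rw [Real.norm_of_nonneg (sq_nonneg _)]
    exact hb y
  rw [lintegral_sq_eq_lintegral_fourier_sq hG hmem]
  refine lintegral_mono fun y => ?_
  rw [← ofReal_norm, ← ENNReal.ofReal_pow (norm_nonneg _)]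
  exact ENNReal.ofReal_le_ofReal (hb y)

/-- Fatou's lemma along σ = 1 + 1/(k+1), using the L² bound uniform in σ. -/
theorem integrable_mertensExp_one_sq : Integrable fun u => mertensExp 1 u ^ 2 := by
  obtain ⟨B, hB, hle⟩ := exists_lintegral_mertensExp_le
  have hlim : ∀ u, Tendsto (fun k : ℕ => ‖(mertensExp (1 + 1 / ((k : ℝ) + 1)) u : ℂ)‖ₑ ^ 2) atTop
      (𝓝 (‖(mertensExp 1 u : ℂ)‖ₑ ^ 2)) := fun u => by
    have h1 : Tendsto (fun k : ℕ => 1 + 1 / ((k : ℝ) + 1)) atTop (𝓝 1) := by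
      simpa using tendsto_one_div_add_atTop_nhds_zero_nat.const_add (1 : ℝ)
    have h2 : Continuous fun σ => ‖(mertensExp σ u : ℂ)‖ₑ ^ 2 := by
      have : Continuous fun σ => (mertensExp σ u : ℂ) := by
        unfold mertensExp; fun_prop
      exact (ENNReal.continuous_pow 2).comp this.enorm
    exact (h2.tendsto 1).comp h1
  have hfin : ∫⁻ u, ‖(mertensExp 1 u : ℂ)‖ₑ ^ 2 ≤ B := by
    calc ∫⁻ u, ‖(mertensExp 1 u : ℂ)‖ₑ ^ 2
        = ∫⁻ u, liminf (fun k : ℕ => ‖(mertensExp (1 + 1 / ((k : ℝ) + 1)) u : ℂ)‖ₑ ^ 2) atTop := by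
          congr 1; funext u; exact (hlim u).liminf_eq.symm
      _ ≤ liminf (fun k : ℕ => ∫⁻ u, ‖(mertensExp (1 + 1 / ((k : ℝ) + 1)) u : ℂ)‖ₑ ^ 2) atTop :=
          lintegral_liminf_le fun k => by
            have := measurable_mertensExp (1 + 1 / ((k : ℝ) + 1))
            fun_prop
      _ ≤ liminf (fun _ : ℕ => B) atTop := by
          refine liminf_le_liminf (Eventually.of_forall fun k => hle _ ?_ ?_)
          · have : (0 : ℝ) < 1 / ((k : ℝ) + 1) := by positivity
            linarith
          · have : 1 / ((k : ℝ) + 1) ≤ 1 := by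
              rw [div_le_one (by positivity)]; linarith [k.cast_nonneg (α := ℝ)]
            linarith
      _ = B := liminf_const B
  refine ⟨((measurable_mertensExp 1).pow_const 2).aestronglyMeasurable, ?_⟩
  rw [HasFiniteIntegral]
  refine lt_of_le_of_lt (le_of_eq ?_) (hfin.trans_lt hB)
  congr 1; funext u
  rw [enorm_pow, ← ofReal_norm, ← ofReal_norm, norm_real]

end

/-! ### From the L² bound to ∑ |M(n)|/n² < ∞. -/

section

open MeasureTheory Set Filter Topology

/-- With w the integrand, w = (v w) · v⁻¹ ≤ (v w)² + v⁻², and both squares are integrable on (1, ∞).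
-/
theorem integrableOn_exp_neg_mul_abs_mertens :
    IntegrableOn (fun v : ℝ => Real.exp (-v) * |mertens ⌊Real.exp v⌋₊|) (Ioi 1) := by
  have h1 := integrable_mertensExp_one_sq.comp_neg.integrableOn (s := Ioi (1 : ℝ))
  have h2 : IntegrableOn (fun v : ℝ => v ^ (-2 : ℝ)) (Ioi 1) :=
    integrableOn_Ioi_rpow_of_lt (by norm_num) one_pos
  have hm : Measurable fun v : ℝ => Real.exp (-v) * |mertens ⌊Real.exp v⌋₊| := by
    have : Measurable fun v : ℝ => mertens ⌊Real.exp v⌋₊ :=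
      (measurable_from_top (f := mertens)).comp (Nat.measurable_floor.comp (by fun_prop))
    fun_prop
  refine Integrable.mono' (h1.add h2) hm.aestronglyMeasurable ?_
  filter_upwards [ae_restrict_mem measurableSet_Ioi] with v hv
  have hv : 1 < v := hv
  have hv0 : 0 < v := by linarith
  rw [Real.norm_of_nonneg (by positivity)]
  simp only [Pi.add_apply, mertensExp, neg_neg, one_mul]
  set w := Real.exp (-v) * |mertens ⌊Real.exp v⌋₊| with hw
  have e1 : (Real.exp (-v) * (v * mertens ⌊Real.exp v⌋₊)) ^ 2 = (v * w) ^ 2 := by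
    rw [hw]; simp only [mul_pow, sq_abs]; ring
  have e2 : v ^ (-2 : ℝ) = v⁻¹ ^ 2 := by
    rw [Real.rpow_neg hv0.le, inv_pow]; norm_cast
  rw [e1, e2]
  have e3 : v * w * v⁻¹ = w := by field_simp
  nlinarith [sq_nonneg (v * w - v⁻¹), sq_nonneg (v * w), sq_nonneg v⁻¹]

/-- The prime number theorem in the form `∑ |M(n)| / n² < ∞`. -/
theorem summable_abs_mertens_div_sq : Summable fun n : ℕ => |mertens n| / (n : ℝ) ^ 2 := by
  -- On the n-th interval ⌊e^v⌋ = n + 3. The shift by 3 places all intervals in (1, ∞), since e < 3.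
  -- With N = n + 3 each has length at least 1/(N+1), and the factor 4 below comes from N/(N+1) ≥
  -- 1/2.
  set s : ℕ → Set ℝ := fun n => Ico (Real.log ((n : ℝ) + 3)) (Real.log ((n : ℝ) + 1 + 3)) with hs
  set f : ℝ → ℝ := fun v => Real.exp (-v) * |mertens ⌊Real.exp v⌋₊| with hf
  have hlog : ∀ n : ℕ, 1 < Real.log ((n : ℝ) + 3) := fun n => by
    rw [Real.lt_log_iff_exp_lt (by positivity)]
    linarith [Real.exp_one_lt_three, n.cast_nonneg (α := ℝ)]
  have hmono : Monotone fun n : ℕ => Real.log ((n : ℝ) + 3) := fun m n h => by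
    have : (m : ℝ) ≤ n := by exact_mod_cast h
    exact Real.log_le_log (by positivity) (by linarith)
  have hdisj : Pairwise (Function.onFun Disjoint s) := by
    have := hmono.pairwise_disjoint_on_Ico_succ
    simpa [hs, Order.succ] using this
  have hsub : ∀ n, s n ⊆ Ioi 1 := fun n v hv => lt_of_lt_of_le (hlog n) hv.1
  have hsum : Summable fun n => ∫ v in s n, f v :=
    (hasSum_integral_iUnion (fun n => measurableSet_Ico) hdisj
      (integrableOn_exp_neg_mul_abs_mertens.mono_set (iUnion_subset hsub))).summable
  rw [← summable_nat_add_iff 3]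
  refine Summable.of_nonneg_of_le (fun n => by positivity) (fun n => ?_) (hsum.mul_left 4)
  set N : ℝ := (n : ℝ) + 3 with hN
  have hN0 : 0 < N := by positivity
  have hN1 : 1 ≤ N := by rw [hN]; linarith [n.cast_nonneg (α := ℝ)]
  have hfl : ∀ v ∈ s n, (N + 1)⁻¹ * |mertens (n + 3)| ≤ f v := fun v hv => by
    have h1 : N ≤ Real.exp v := (Real.log_le_iff_le_exp hN0).1 hv.1
    have h2 : Real.exp v < N + 1 := by
      have := (Real.lt_log_iff_exp_lt (by positivity)).1 hv.2
      rw [hN]; linarith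
    have h3 : ⌊Real.exp v⌋₊ = n + 3 := by
      rw [Nat.floor_eq_iff (Real.exp_pos v).le]
      push_cast
      exact ⟨h1, h2⟩
    simp only [hf, h3, Real.exp_neg]
    gcongr
  have hlen : (N + 1)⁻¹ ≤ Real.log (N + 1) - Real.log N := by
    rw [← Real.log_div (by positivity) hN0.ne']
    refine le_trans (le_of_eq ?_) (Real.one_sub_inv_le_log_of_pos (by positivity))
    field_simp; ring
  have hint : (N + 1)⁻¹ * |mertens (n + 3)| * (Real.log (N + 1) - Real.log N) ≤
      ∫ v in s n, f v := by
    have := setIntegral_ge_of_const_le_real (μ := volume) (s := s n) measurableSet_Ico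
      (by simp [hs]) hfl (integrableOn_exp_neg_mul_abs_mertens.mono_set (hsub n))
    rw [hs, Real.volume_real_Ico_of_le (hmono n.le_succ |>.trans (by simp))] at this
    rw [show N + 1 = (n : ℝ) + 1 + 3 by rw [hN]; ring] at *
    exact this
  push_cast
  calc |mertens (n + 3)| / N ^ 2 ≤ 4 * ((N + 1)⁻¹ * |mertens (n + 3)| * (N + 1)⁻¹) := by
        rw [div_le_iff₀ (by positivity)]
        have : 1 ≤ 4 * ((N + 1)⁻¹ * N) ^ 2 := by
          have h : 1 / 2 ≤ (N + 1)⁻¹ * N := by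
            rw [inv_mul_eq_div, le_div_iff₀ (by positivity)]; linarith
          nlinarith
        calc |mertens (n + 3)| = |mertens (n + 3)| * 1 := (mul_one _).symm
          _ ≤ |mertens (n + 3)| * (4 * ((N + 1)⁻¹ * N) ^ 2) := by gcongr
          _ = _ := by ring
    _ ≤ 4 * ((N + 1)⁻¹ * |mertens (n + 3)| * (Real.log (N + 1) - Real.log N)) := by gcongr
    _ ≤ 4 * ∫ v in s n, f v := by gcongr

end

theorem theorem2p1 (x a : ℝ) (hx : 0 < x) (ha : 0 < a) :
    (∀ y : ℝ, 0 < y → Summable (rieszTerm (a ^ 2 * y))) ∧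
    MeasureTheory.IntegrableOn
      (fun y : ℝ => rieszFun (a ^ 2 * y) * heatFactor x y) (Set.Ioi 0) ∧
    Filter.Tendsto (fun N : ℕ => Real.pi / 2 * gramDerivPartialSum a x N) Filter.atTop
      (nhds (a * ∫ y in Set.Ioi (0 : ℝ), rieszFun (a ^ 2 * y) * heatFactor x y)) :=
  ⟨fun _ hy => summable_rieszTerm (by positivity),
    rieszFun_mul_heatFactor_of_summable_mertens summable_abs_mertens_div_sq hx ha⟩
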